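/- Let $n\ge 2$, let $S^n\subset\mathbb R^{n+1}$ be the unit sphere with the metric $g$ induced from $\mathbb R^{n+1}$, and let $\omega$ be the restriction to $S^n$ of a $2$-form on $\mathbb R^{n+1}$ whose components in Cartesian coordinates are constant. In local coordinates $x=(x^1,\dots,x^n)$ on $S^n$ with corresponding momenta $p=(p_1,\dots,p_n)$, consider on $T^*S^n$ the perturbed symplectic form $\Omega_{\mathrm{pert}}=\omega+\sum_{i=1}^n dp_i\wedge dx^i$ ($\omega$ being pulled back to $T^*S^n$) and the Hamiltonian $H(x,p)=\tfrac12\sum_{i,j=1}^n g^{ij}(x)p_ip_j$; the magnetic geodesic flow of $(S^n,g,\omega)$ is the Hamiltonian flow of $H$ with respect to $\Omega_{\mathrm{pert}}$. This flow is Liouville integrable by means of integrals linear and quadratic in momenta. More precisely, there exist $n$ smooth functions $F_1,\dots,F_n:T^*S^n\to\mathbb R$ such that: 1. $H$ is a linear combination of $F_1,\dots,F_n$ with constant coefficients; 2. $F_1,\dots,F_n$ Poisson-commute with each other, and with $H$, with respect to $\Omega_{\mathrm{pert}}$; 3. $F_1,\dots,F_n$ are functionally independent: their differentials are linearly independent at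 almost every point of $T^*S^n$; 4. each of the first $\lfloor n/2\rfloor$ functions is quadratic in momenta, i.e. of the form $Q_x(p)+p(V_x)+U(x)$ with $Q_x$ a quadratic form on $T^*_xS^n$, $V_x\in T_xS^n$, $U(x)\in\mathbb R$, and $Q$ not identically zero; each of the remaining $n-\lfloor n/2\rfloor=\lceil n/2\rceil$ functions is linear in momenta, i.e. of the form $p(V_x)+U(x)$ with $V$ not identically zero. -/

import Mathlib

open scoped Manifold ContDiff
open MeasureTheory

namespace MagneticSphere

/-! ### Cotangent bundles, canonical coordinates and perturbed symplectic forms -/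

section General

variable {n : ℕ} (M : Type*) [TopologicalSpace M]
  [ChartedSpace (EuclideanSpace ℝ (Fin n)) M]

/-- The cotangent space of an `n`-dimensional manifold at a point. -/
abbrev CotangentSpace {M : Type*} [TopologicalSpace M]
    [ChartedSpace (EuclideanSpace ℝ (Fin n)) M] (x : M) : Type :=
  TangentSpace (𝓡 n) x →L[ℝ] ℝ

/-- The cotangent bundle `T*M` of an `n`-dimensional manifold. -/
abbrev CotangentBundle : Type _ :=
  Bundle.TotalSpace (EuclideanSpace ℝ (Fin n) →L[ℝ] ℝ)
    (fun x : M => CotangentSpace (n := n) x)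

variable {M}

/-- The inverse of the canonical coordinate system on `T*M` induced by a local coordinate system
`e = (x¹, …, xⁿ)` of `M`: it sends `(x, p)` to the covector `∑ᵢ pᵢ dxⁱ` at the point with
coordinates `x`. (`innerSL ℝ p` is the linear form `u ↦ ∑ᵢ pᵢ uᵢ`.) -/
noncomputable def canonicalCoord
    (e : OpenPartialHomeomorph M (EuclideanSpace ℝ (Fin n)))
    (z : EuclideanSpace ℝ (Fin n) × EuclideanSpace ℝ (Fin n)) : CotangentBundle (n := n) M :=
  ⟨e.symm z.1, (innerSL ℝ z.2).comp (mfderiv (𝓡 n) (𝓡 n) e (e.symm z.1))⟩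

/-- The perturbed symplectic form `β + ∑ᵢ dpᵢ ∧ dxⁱ` (the 2-form `β` of `M` being pulled back to
`T*M`) in the canonical coordinates `(x, p)` induced by `e`, at a point with base coordinates `x`,
evaluated on the tangent vectors `X = (dx, dp)(X)` and `Y = (dx, dp)(Y)`. -/
noncomputable def perturbedForm
    (β : ∀ x : M, TangentSpace (𝓡 n) x [⋀^Fin 2]→L[ℝ] ℝ)
    (e : OpenPartialHomeomorph M (EuclideanSpace ℝ (Fin n))) (x : EuclideanSpace ℝ (Fin n))
    (X Y : EuclideanSpace ℝ (Fin n) × EuclideanSpace ℝ (Fin n)) : ℝ :=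
  β (e.symm x) ![mfderiv (𝓡 n) (𝓡 n) e.symm x X.1, mfderiv (𝓡 n) (𝓡 n) e.symm x Y.1]
    + ∑ i, (X.2 i * Y.1 i - Y.2 i * X.1 i)

/-- `X` is the value at `z = (x, p)` of the Hamiltonian vector field of `F` with respect to the
perturbed symplectic form, in the canonical coordinates induced by `e`: `Ω(X, ·) = dF`. -/
def IsHamiltonianVector
    (β : ∀ x : M, TangentSpace (𝓡 n) x [⋀^Fin 2]→L[ℝ] ℝ)
    (F : CotangentBundle (n := n) M → ℝ)
    (e : OpenPartialHomeomorph M (EuclideanSpace ℝ (Fin n)))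
    (z X : EuclideanSpace ℝ (Fin n) × EuclideanSpace ℝ (Fin n)) : Prop :=
  ∀ Y, perturbedForm β e z.1 X Y = fderiv ℝ (F ∘ canonicalCoord e) z Y

/-- `F` and `G` Poisson-commute with respect to the perturbed symplectic form `Ω`: the Poisson
bracket `{F, G} = Ω(X_F, X_G)` vanishes at every point, in every local coordinate system. -/
def PoissonCommute
    (β : ∀ x : M, TangentSpace (𝓡 n) x [⋀^Fin 2]→L[ℝ] ℝ)
    (F G : CotangentBundle (n := n) M → ℝ) : Prop :=
  ∀ e ∈ IsManifold.maximalAtlas (𝓡 n) ∞ M, ∀ z, z.1 ∈ e.target →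
    ∀ X Y, IsHamiltonianVector β F e z X → IsHamiltonianVector β G e z Y →
      perturbedForm β e z.1 X Y = 0

/-- The perturbed form is nondegenerate: Hamiltonian vectors exist and are unique. -/
theorem existsUnique_isHamiltonianVector
    (β : ∀ x : M, TangentSpace (𝓡 n) x [⋀^Fin 2]→L[ℝ] ℝ)
    (F : CotangentBundle (n := n) M → ℝ)
    (e : OpenPartialHomeomorph M (EuclideanSpace ℝ (Fin n)))
    (z : EuclideanSpace ℝ (Fin n) × EuclideanSpace ℝ (Fin n)) :
    ∃! X, IsHamiltonianVector β F e z X := by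
  set L := fderiv ℝ (F ∘ canonicalCoord e) z with hL
  let A : EuclideanSpace ℝ (Fin n) → TangentSpace (𝓡 n) (e.symm z.1) :=
    fun u => mfderiv (𝓡 n) (𝓡 n) e.symm z.1 u
  have hup : ∀ a b c : TangentSpace (𝓡 n) (e.symm z.1),
      Function.update ![a, b] 1 c = ![a, c] := fun a b c => by
    funext i
    fin_cases i <;> rfl
  let B : EuclideanSpace ℝ (Fin n) → EuclideanSpace ℝ (Fin n) →ₗ[ℝ] ℝ := fun u =>
    { toFun := fun v => β (e.symm z.1) ![A u, A v]
      map_add' := fun v w => by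
        have h := (β (e.symm z.1)).map_update_add ![A u, 0] 1 (A v) (A w)
        have hA : A (v + w) = A v + A w :=
          (mfderiv (𝓡 n) (𝓡 n) e.symm z.1).map_add v w
        rw [hA]
        rw [hup, hup, hup] at h
        exact h
      map_smul' := fun c v => by
        have h := (β (e.symm z.1)).map_update_smul ![A u, 0] 1 c (A v)
        have hA : A (c • v) = c • A v :=
          (mfderiv (𝓡 n) (𝓡 n) e.symm z.1).map_smul c v
        rw [hA]
        rw [hup, hup] at h
        exact h }
  have hB : ∀ X Y, perturbedForm β e z.1 X Y
      = B X.1 Y.1 + ∑ i, (X.2 i * Y.1 i - Y.2 i * X.1 i) := fun X Y => rfl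
  have hsum : ∀ v : EuclideanSpace ℝ (Fin n),
      v = ∑ i, v i • EuclideanSpace.single i (1 : ℝ) := fun v => by
    ext j
    simp [Finset.sum_apply, Pi.single_apply]
  have key : ∀ X, IsHamiltonianVector β F e z X ↔
      (∀ i, X.1 i = - L (0, EuclideanSpace.single i (1 : ℝ))) ∧
      ∀ i, X.2 i = L (EuclideanSpace.single i (1 : ℝ), 0)
        - B X.1 (EuclideanSpace.single i (1 : ℝ)) := by
    intro X
    constructor
    · intro h
      refine ⟨fun i => ?_, fun i => ?_⟩
      · have := h (0, EuclideanSpace.single i (1 : ℝ))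
        rw [hB, ← hL] at this
        simp at this
        linarith
      · have := h (EuclideanSpace.single i (1 : ℝ), 0)
        rw [hB, ← hL] at this
        simp at this
        linarith
    · rintro ⟨h1, h2⟩ Y
      rw [hB, ← hL]
      have hY : Y = (Y.1, 0) + (0, Y.2) := by simp
      have e1 : L (Y.1, 0) = ∑ i, Y.1 i * L (EuclideanSpace.single i (1 : ℝ), 0) := by
        have : L (Y.1, 0) = (L.comp (ContinuousLinearMap.inl ℝ _ _)) Y.1 := rfl
        rw [this]
        conv_lhs => rw [hsum Y.1]
        rw [map_sum]
        simp
      have e2 : L (0, Y.2) = ∑ i, Y.2 i * L (0, EuclideanSpace.single i (1 : ℝ)) := by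
        have : L (0, Y.2) = (L.comp (ContinuousLinearMap.inr ℝ _ _)) Y.2 := rfl
        rw [this]
        conv_lhs => rw [hsum Y.2]
        rw [map_sum]
        simp
      have e3 : B X.1 Y.1 = ∑ i, Y.1 i * B X.1 (EuclideanSpace.single i (1 : ℝ)) := by
        conv_lhs => rw [hsum Y.1]
        rw [map_sum]
        simp
      conv_rhs => rw [hY, map_add, e1, e2]
      rw [e3, ← Finset.sum_add_distrib, ← Finset.sum_add_distrib]
      refine Finset.sum_congr rfl fun i _ => ?_
      rw [h1, h2]
      ring
  refine ⟨(WithLp.toLp 2 fun i => - L (0, EuclideanSpace.single i (1 : ℝ)),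
    WithLp.toLp 2 fun i => L (EuclideanSpace.single i (1 : ℝ), 0)
      - B (WithLp.toLp 2 fun i => - L (0, EuclideanSpace.single i (1 : ℝ)))
        (EuclideanSpace.single i (1 : ℝ))), ?_, ?_⟩
  · exact (key _).2 ⟨fun i => rfl, fun i => rfl⟩
  · intro X hX
    obtain ⟨h1, h2⟩ := (key X).1 hX
    have h1' : X.1 = WithLp.toLp 2 fun i => - L (0, EuclideanSpace.single i (1 : ℝ)) := by
      ext i
      exact h1 i
    refine Prod.ext h1' ?_
    ext i
    rw [h2 i, h1']

/-- The functions `F i` on `T*M` are functionally independent: their differentials are linearly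
independent almost everywhere, i.e. outside a set which has Lebesgue measure zero in all canonical
coordinate systems. -/
def FunctionallyIndependent {ι : Type*} (F : ι → CotangentBundle (n := n) M → ℝ) : Prop :=
  ∀ e ∈ IsManifold.maximalAtlas (𝓡 n) ∞ M,
    ∀ᵐ z : EuclideanSpace ℝ (Fin n) × EuclideanSpace ℝ (Fin n), z.1 ∈ e.target →
      LinearIndependent ℝ (fun i => fderiv ℝ (F i ∘ canonicalCoord e) z)

/-- The Hamiltonian `H = ½ ∑ᵢⱼ gⁱʲ pᵢ pⱼ` of the metric `g`, where `(gⁱʲ)` is the inverse of the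
Gram matrix `(gᵢⱼ)` of `g` and `pᵢ` are the components of the covector, all with respect to the
standard basis of the tangent space. -/
noncomputable def kineticHamiltonian
    (g : ∀ x : M, LinearMap.BilinForm ℝ (TangentSpace (𝓡 n) x))
    (ξ : CotangentBundle (n := n) M) : ℝ :=
  let b : Fin n → TangentSpace (𝓡 n) ξ.proj := fun i => EuclideanSpace.single i (1 : ℝ)
  let gInv : Matrix (Fin n) (Fin n) ℝ := (Matrix.of fun i j => g ξ.proj (b i) (b j))⁻¹
  1 / 2 * ∑ i, ∑ j, gInv i j * ξ.snd (b i) * ξ.snd (b j)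

/-- `F` is a (possibly inhomogeneous) quadratic polynomial in the momenta, with coefficients
depending on the position, whose homogeneous quadratic part does not vanish identically.
(If `F` is smooth, then so are the coefficients.) -/
def IsQuadraticInMomenta (F : CotangentBundle (n := n) M → ℝ) : Prop :=
  ∃ (Q : ∀ x : M, QuadraticForm ℝ (CotangentSpace (n := n) x))
    (V : ∀ x : M, TangentSpace (𝓡 n) x) (U : M → ℝ),
    (∃ x, Q x ≠ 0) ∧ ∀ (x : M) (ξ : CotangentSpace (n := n) x), F ⟨x, ξ⟩ = Q x ξ + ξ (V x) + U x

/-- `F` is a (possibly inhomogeneous) linear polynomial in the momenta, with coefficients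
depending on the position, whose homogeneous linear part does not vanish identically.
(If `F` is smooth, then so are the coefficients.) -/
def IsLinearInMomenta (F : CotangentBundle (n := n) M → ℝ) : Prop :=
  ∃ (V : ∀ x : M, TangentSpace (𝓡 n) x) (U : M → ℝ),
    (∃ x, V x ≠ 0) ∧ ∀ (x : M) (ξ : CotangentSpace (n := n) x), F ⟨x, ξ⟩ = ξ (V x) + U x

end General

/-! ### The round sphere and its constant magnetic forms -/

/-- The unit sphere `Sⁿ` in `ℝⁿ⁺¹`. -/
abbrev Sphere (n : ℕ) : Type :=
  Metric.sphere (0 : EuclideanSpace ℝ (Fin (n + 1))) 1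

/-- The differential at `x` of the inclusion `Sⁿ → ℝⁿ⁺¹`. -/
noncomputable def inclusionDeriv {n : ℕ} (x : Sphere n) :
    TangentSpace (𝓡 n) x →L[ℝ] EuclideanSpace ℝ (Fin (n + 1)) :=
  mfderiv (𝓡 n) 𝓘(ℝ, EuclideanSpace ℝ (Fin (n + 1)))
    (fun y : Sphere n => (y : EuclideanSpace ℝ (Fin (n + 1)))) x

/-- The round metric of `Sⁿ`, induced by the Euclidean inner product of `ℝⁿ⁺¹`. -/
noncomputable def roundMetric (n : ℕ) (x : Sphere n) :
    LinearMap.BilinForm ℝ (TangentSpace (𝓡 n) x) :=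
  (innerₗ (EuclideanSpace ℝ (Fin (n + 1)))).compl₁₂
    (inclusionDeriv x).toLinearMap (inclusionDeriv x).toLinearMap

/-- The restriction to `Sⁿ` of the 2-form on `ℝⁿ⁺¹` with the constant value `α`. -/
noncomputable def constantMagneticForm {n : ℕ}
    (α : EuclideanSpace ℝ (Fin (n + 1)) [⋀^Fin 2]→L[ℝ] ℝ) (x : Sphere n) :
    TangentSpace (𝓡 n) x [⋀^Fin 2]→L[ℝ] ℝ :=
  α.compContinuousLinearMap (inclusionDeriv x)

end MagneticSphere

/-! The magnetic form is exact. Writing `α ![a, b] = 2 ⟨K a, b⟩` with `K` skew, the vector field `K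
x` is a vector potential. If `v` is the tangent vector dual to the momentum and `w = v + K x`
(`gaugedMomentum`), then `(x, w)` identifies `T*Sⁿ` with `{|x| = 1, ⟨x, w⟩ = 0}`, and the perturbed
form becomes the restriction of the canonical form of `ℝ²ⁿ⁺²` (`perturbedForm_eq`). For functions of
`(x, w)` whose `w`-gradient is orthogonal to `x`, the bracket is the ambient canonical one
(`perturbedForm_hamiltonian`). This covers every function built from the angular momenta `Mₐᵦ` of
`(x, w)` and from `x`.

Choose an orthonormal basis in which `K` consists of `2 × 2` blocks with parameters `κₗ`
(`exists_skew_normal_form`). Then `H = ½ |w - K x|²` is the Neumann Hamiltonian `¼ ∑ Mₐᵦ² + ½ ∑ κ²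
yₐ²` plus a combination of the block rotations `M₂ₗ,₂ₗ₊₁` (`kineticHamiltonian_eq_sphereIntegral`).
The `⌈n/2⌉` rotations of the complete blocks are the linear integrals. The quadratic ones are
integrals of Neumann type `¼ ∑ σ M² + ½ ∑ u y²` with coefficients constant on blocks, hence
invariant under the block rotations. Two of them commute if the weights satisfy a cyclic identity
and match the potentials (`bracket_momentumEnergy`), as do the divided differences `sᵢⱼ = (vᵢ - vⱼ)
/ (bᵢ - bⱼ)`, `u = v`, with `b = κ²`. Coinciding frequencies are handled by a second divided
difference inside each level set of `b` (`exists_commuting_weights`). There are `⌊n/2⌋ + 1` blocks,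
and `v` counts modulo constants, which gives `⌊n/2⌋` integrals including `H`.

For independence it suffices to consider differentials along the fibres. These depend affinely on
the momentum, so independence at one momentum over almost every base point is enough
(`ae_linearIndependent_affine`). At a momentum that is radial in each block, the quadratic integrals
give commuting weighted Laplacians on the set of blocks, and these take independent values at a
suitable vector (`exists_laplacian_independent`). -/

namespace MagneticSphere

/-! ### Orthogonal normal form of skew-symmetric operators. -/

section SkewNormalForm

open Module

variable {E : Type*} [NormedAddCommGroup E] [InnerProductSpace ℝ E] [FiniteDimensional ℝ E]

/-- A skew-symmetric operator on a space of dimension at least two leaves a plane invariant. -/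
theorem exists_invariant_plane (K : E →ₗ[ℝ] E) (hK : ∀ x y, inner ℝ (K x) y = - inner ℝ x (K y))
    (hE : 2 ≤ finrank ℝ E) :
    ∃ e₀ e₁ : E, ‖e₀‖ = 1 ∧ ‖e₁‖ = 1 ∧ inner ℝ e₀ e₁ = 0 ∧
      ∀ w, inner ℝ w e₀ = 0 → inner ℝ w e₁ = 0 → inner ℝ w (K e₀) = 0 ∧ inner ℝ w (K e₁) = 0 := by
  by_cases h0 : K = 0
  · let b := stdOrthonormalBasis ℝ E
    refine ⟨b ⟨0, by omega⟩, b ⟨1, by omega⟩, b.norm_eq_one _, b.norm_eq_one _,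
      b.inner_eq_zero (by simp), fun w _ _ => by simp [h0]⟩
  -- The square of `K` is symmetric, so it has an eigenbasis. For an eigenvector `b` with `K b ≠ 0`,
  -- the plane spanned by `b` and `K b` is invariant, and `K b ⊥ b` by skewness.
  · have hS : (K ∘ₗ K).IsSymmetric := fun x y => by
      simp only [LinearMap.comp_apply]
      rw [hK, hK]
      simp
    let b := hS.eigenvectorBasis rfl
    obtain ⟨i, hi⟩ : ∃ i, K (b i) ≠ 0 := by
      by_contra! h
      exact h0 (b.toBasis.ext fun i => by simpa using h i)
    have hn : ‖K (b i)‖ ≠ 0 := by simpa using hi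
    have hKK : K (K (b i)) = (hS.eigenvalues rfl i : ℝ) • b i :=
      hS.apply_eigenvectorBasis rfl i
    have hself : inner ℝ (b i) (K (b i)) = 0 := by
      have := hK (b i) (b i)
      rw [real_inner_comm] at this
      linarith
    refine ⟨b i, ‖K (b i)‖⁻¹ • K (b i), b.norm_eq_one i, ?_, ?_, fun w h₀ h₁ => ⟨?_, ?_⟩⟩
    · rw [norm_smul, norm_inv, norm_norm, inv_mul_cancel₀ hn]
    · rw [inner_smul_right, hself, mul_zero]
    · rw [inner_smul_right] at h₁
      exact (mul_eq_zero.1 h₁).resolve_left (inv_ne_zero hn)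
    · rw [map_smul, hKK, inner_smul_right, inner_smul_right, h₀]
      simp

/-- The entries of the block diagonal matrix with `2 × 2` blocks `(0, 1; -1, 0)`. -/
def blockRotation (a c : ℕ) : ℝ :=
  if a + 1 = c ∧ Even a then 1 else if c + 1 = a ∧ Even c then -1 else 0

theorem blockRotation_antisymm (a c : ℕ) : blockRotation a c = - blockRotation c a := by
  unfold blockRotation
  split_ifs <;> first | omega | simp

theorem blockRotation_ne_zero {a c : ℕ} (h : blockRotation a c ≠ 0) : a / 2 = c / 2 := by
  unfold blockRotation at h
  split_ifs at h with h1 h2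
  · obtain ⟨h1, k, hk⟩ := h1; omega
  · obtain ⟨h1, k, hk⟩ := h2; omega
  · simp at h

theorem blockRotation_add_two (a c : ℕ) : blockRotation (a + 2) (c + 2) = blockRotation a c := by
  unfold blockRotation
  have h1 : Even (a + 2) ↔ Even a := by simp [Nat.even_add]
  have h2 : Even (c + 2) ↔ Even c := by simp [Nat.even_add]
  have h3 : a + 2 + 1 = c + 2 ↔ a + 1 = c := by omega
  have h4 : c + 2 + 1 = a + 2 ↔ c + 1 = a := by omega
  simp only [h1, h2, h3, h4]

/-- Orthogonal normal form of a skew-symmetric operator. -/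
theorem exists_skew_normal_form (N : ℕ) : ∀ {E : Type _} [NormedAddCommGroup E]
    [InnerProductSpace ℝ E] [FiniteDimensional ℝ E] (K : E →ₗ[ℝ] E)
    (_ : ∀ x y, inner ℝ (K x) y = - inner ℝ x (K y)) (_ : finrank ℝ E = N),
    ∃ (f : Fin N → E) (κ : ℕ → ℝ), Orthonormal ℝ f ∧
      (∀ a c : Fin N, inner ℝ (f a) (K (f c)) = κ (a / 2) * blockRotation a c) ∧
      ∀ l, N ≤ 2 * l + 1 → κ l = 0 := by
  induction N using Nat.twoStepInduction with
  | zero =>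
    intro E _ _ _ K _ _
    exact ⟨Fin.elim0, 0, ⟨fun i => i.elim0, fun i => i.elim0⟩, fun i => i.elim0, fun _ _ => rfl⟩
  | one =>
    intro E _ _ _ K hK hE
    let b := (stdOrthonormalBasis ℝ E).reindex (finCongr hE)
    refine ⟨b, 0, b.orthonormal, fun a c => ?_, fun _ _ => rfl⟩
    have hac : a = c := Subsingleton.elim _ _
    have := hK (b c) (b c)
    rw [real_inner_comm] at this
    rw [hac]
    simp
    linarith
  | more N ih _ =>
    intro E _ _ _ K hK hE
    obtain ⟨e₀, e₁, h₀, h₁, h₀₁, hinv⟩ := exists_invariant_plane K hK (by omega)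
    have hself : ∀ x, inner ℝ x (K x) = 0 := fun x => by
      have := hK x x
      rw [real_inner_comm] at this
      linarith
    let P : Submodule ℝ E := Submodule.span ℝ (Set.range ![e₀, e₁])
    have hon : Orthonormal ℝ ![e₀, e₁] := by
      rw [orthonormal_iff_ite]
      intro i j
      fin_cases i <;> fin_cases j <;> simp [h₀, h₁, h₀₁, real_inner_comm]
    have hP : finrank ℝ P = 2 := by
      simpa using finrank_span_eq_card hon.linearIndependent
    have hPo : finrank ℝ Pᗮ = N := by
      have := P.finrank_add_finrank_orthogonal
      omega
    have hmem : ∀ w, w ∈ Pᗮ ↔ inner ℝ w e₀ = 0 ∧ inner ℝ w e₁ = 0 := fun w => by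
      constructor
      · intro h
        rw [Submodule.mem_orthogonal'] at h
        exact ⟨h _ (Submodule.subset_span ⟨0, rfl⟩), h _ (Submodule.subset_span ⟨1, rfl⟩)⟩
      · rintro ⟨h, h'⟩
        rw [Submodule.mem_orthogonal']
        intro u hu
        refine Submodule.span_induction (p := fun u _ => inner ℝ w u = 0) ?_ (by simp) ?_ ?_ hu
        · rintro _ ⟨i, rfl⟩
          fin_cases i
          · exact h
          · exact h'
        · intro x y _ _ hx hy
          rw [inner_add_right, hx, hy, add_zero]
        · intro c x _ hx
          rw [inner_smul_right, hx, mul_zero]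
    have hKP : ∀ w ∈ Pᗮ, K w ∈ Pᗮ := fun w hw => by
      have := hinv w ((hmem w).1 hw).1 ((hmem w).1 hw).2
      exact (hmem _).2 ⟨by rw [hK, this.1, neg_zero], by rw [hK, this.2, neg_zero]⟩
    obtain ⟨f, κ, hf, hfK, hκ⟩ := ih (E := Pᗮ) (K.restrict hKP)
      (fun x y => hK (x : E) (y : E)) hPo
    have hf₀ : ∀ a, inner ℝ (f a : E) e₀ = 0 := fun a => ((hmem _).1 (f a).2).1
    have hf₁ : ∀ a, inner ℝ (f a : E) e₁ = 0 := fun a => ((hmem _).1 (f a).2).2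
    have hf₀' : ∀ a, inner ℝ e₀ (f a : E) = 0 := fun a => by rw [real_inner_comm, hf₀]
    have hf₁' : ∀ a, inner ℝ e₁ (f a : E) = 0 := fun a => by rw [real_inner_comm, hf₁]
    have h₁₀ : inner ℝ e₁ e₀ = 0 := by rw [real_inner_comm, h₀₁]
    have hfK' : ∀ a c, inner ℝ (f a : E) (K (f c)) = κ (a / 2) * blockRotation a c :=
      fun a c => hfK a c
    have hff : ∀ a c, inner ℝ (f a : E) (f c : E) = if a = c then 1 else 0 :=
      fun a c => orthonormal_iff_ite.1 hf a c
    have hd : ∀ a : ℕ, (a + 1 + 1) / 2 = a / 2 + 1 := fun a => by omega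
    -- The invariant plane becomes block `0` and the blocks of its orthogonal complement move up by
    -- one, which shifts basis indices by two.
    refine ⟨Fin.cons e₀ (Fin.cons e₁ fun a => (f a : E)),
      fun l => if l = 0 then inner ℝ e₀ (K e₁) else κ (l - 1), ?_, fun a c => ?_, fun l hl => ?_⟩
    · rw [orthonormal_iff_ite]
      intro a c
      refine Fin.cases ?_ (fun a => Fin.cases ?_ (fun a => ?_) a) a <;>
      refine Fin.cases ?_ (fun c => Fin.cases ?_ (fun c => ?_) c) c <;>
      simp only [Fin.cons_zero, Fin.cons_succ, Fin.succ_inj, hff, hf₀, hf₁, hf₀', hf₁', h₀₁, h₁₀,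
        h₀, h₁, real_inner_self_eq_norm_sq] <;>
      simp [Fin.succ_ne_zero, (Fin.succ_ne_zero _).symm]
    · have hs₀ : ∀ c, inner ℝ e₀ (K (f c)) = 0 := fun c => by
        have := (hmem _).1 (hKP _ (f c).2)
        rw [real_inner_comm]; exact this.1
      have hs₁ : ∀ c, inner ℝ e₁ (K (f c)) = 0 := fun c => by
        have := (hmem _).1 (hKP _ (f c).2)
        rw [real_inner_comm]; exact this.2
      have h10 : inner ℝ e₁ (K e₀) = - inner ℝ e₀ (K e₁) := by
        rw [real_inner_comm, hK]
      refine Fin.cases ?_ (fun a => Fin.cases ?_ (fun a => ?_) a) a <;>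
      refine Fin.cases ?_ (fun c => Fin.cases ?_ (fun c => ?_) c) c <;>
      simp only [Fin.cons_zero, Fin.cons_succ, Fin.val_succ, Fin.val_zero, hself, hs₀, hs₁,
        (hinv _ (hf₀ _) (hf₁ _)).1, (hinv _ (hf₀ _) (hf₁ _)).2, h10, hfK', hd, blockRotation_add_two]
      · simp [blockRotation]
      · simp [blockRotation]
      · simp [blockRotation]
      · simp [blockRotation]
      · simp [blockRotation]
      · simp [blockRotation]
      · simp [blockRotation]
      · simp [blockRotation]
      · simp
    · have : l ≠ 0 := by omega
      simp only [this, if_false]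
      exact hκ _ (by omega)

end SkewNormalForm

/-! ### Commuting symmetric operators and weighted Laplacians. -/

section LinearAlgebra

/-- If a commuting family of symmetric operators is linearly independent, then so are its values
at some vector. -/
theorem exists_linearIndependent_apply {ι E : Type*} [Fintype ι] [NormedAddCommGroup E]
    [InnerProductSpace ℝ E] [FiniteDimensional ℝ E] (T : ι → Module.End ℝ E)
    (hsymm : ∀ i, (T i).IsSymmetric) (hcomm : ∀ i j, Commute (T i) (T j))
    (hT : LinearIndependent ℝ T) : ∃ v, LinearIndependent ℝ fun i => T i v := by
  classical
  let V : (ι → ℝ) → Submodule ℝ E := fun α => ⨅ j, (T j).eigenspace (α j)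
  have hint : DirectSum.IsInternal V :=
    LinearMap.IsSymmetric.directSum_isInternal_of_pairwise_commute hsymm fun i j _ => hcomm i j
  have hind : iSupIndep V := hint.submodule_iSupIndep
  have hfin : {α | V α ≠ ⊥}.Finite := WellFoundedGT.finite_ne_bot_of_iSupIndep hind
  have hex : ∀ α, ∃ v ∈ V α, V α ≠ ⊥ → v ≠ 0 := fun α => by
    by_cases h : V α = ⊥
    · exact ⟨0, zero_mem _, fun h' => absurd h h'⟩
    · obtain ⟨v, hv, hv'⟩ := (Submodule.ne_bot_iff _).1 h
      exact ⟨v, hv, fun _ => hv'⟩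
  choose v hv hv0 using hex
  have heig : ∀ α, ∀ w ∈ V α, ∀ i, T i w = α i • w := fun α w hw i =>
    Module.End.mem_eigenspace_iff.1 ((Submodule.mem_iInf _).1 hw i)
  -- The test vector has a nonzero component in every nontrivial joint eigenspace. A relation `c` at
  -- this vector therefore gives `∑ cᵢ αᵢ = 0` for every joint eigenvalue `α`, so `∑ cᵢ Tᵢ` vanishes
  -- on the whole space.
  refine ⟨∑ α ∈ hfin.toFinset, v α, Fintype.linearIndependent_iff.2 fun c hc => ?_⟩
  have hz : ∑ α ∈ hfin.toFinset, (∑ i, c i * α i) • v α = 0 := by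
    rw [← hc]
    simp only [map_sum, Finset.smul_sum, Finset.sum_smul]
    rw [Finset.sum_comm]
    refine Finset.sum_congr rfl fun i _ => Finset.sum_congr rfl fun α _ => ?_
    rw [heig α _ (hv α), smul_smul]
  have hzero : ∀ α, V α ≠ ⊥ → ∑ i, c i * α i = 0 := fun α hα => by
    have h1 := (iSupIndep_iff_finsetSum_eq_zero_imp_eq_zero V).1 hind hfin.toFinset
      (fun α => (∑ i, c i * α i) • v α) (fun α _ => (V α).smul_mem _ (hv α)) hz α (by simpa using hα)
    exact (smul_eq_zero.1 h1).resolve_right (hv0 α hα)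
  refine Fintype.linearIndependent_iff.1 hT c ?_
  have htop : ⨆ α, V α = ⊤ := hint.submodule_iSup_eq_top
  have : ∀ α, V α ≤ LinearMap.ker (∑ i, c i • T i) := fun α w hw => by
    by_cases hα : V α = ⊥
    · rw [hα, Submodule.mem_bot] at hw
      simp [hw]
    · rw [LinearMap.mem_ker]
      simp only [LinearMap.sum_apply, LinearMap.smul_apply]
      rw [← zero_smul ℝ w, ← hzero α hα, Finset.sum_smul]
      exact Finset.sum_congr rfl fun i _ => by rw [heig α w hw, smul_smul]
  exact LinearMap.ker_eq_top.1 (top_unique (htop ▸ iSup_le this))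

/-- A linearly independent pair extends to a basis. -/
theorem exists_linearIndependent_extending_pair {V : Type*} [AddCommGroup V] [Module ℝ V]
    {x y : V} (hxy : LinearIndependent ℝ ![x, y]) (m : ℕ)
    (hm : m + 2 ≤ Module.finrank ℝ V) :
    ∃ g : Fin (m + 2) → V, LinearIndependent ℝ g ∧ g 0 = x ∧ g 1 = y := by
  induction m with
  | zero => exact ⟨![x, y], hxy, rfl, rfl⟩
  | succ m ih =>
    obtain ⟨g, hg, h0, h1⟩ := ih (by omega)
    obtain ⟨z, hz⟩ := exists_linearIndependent_snoc_of_lt_finrank hg (by omega)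
    refine ⟨Fin.snoc g z, hz, ?_, ?_⟩
    · rw [← h0]; exact Fin.snoc_castSucc (α := fun _ => V) z g 0
    · rw [← h1]; exact Fin.snoc_castSucc (α := fun _ => V) z g 1

/-- Commuting "Laplacians" `ρ ↦ (∑ⱼ sᵢⱼ qⱼ (ρᵢ - ρⱼ))ᵢ` with linearly independent weights `s` take
linearly independent values at some `ρ`. -/
theorem exists_laplacian_independent {ι κ : Type*} [Fintype ι] [Fintype κ]
    (s : ι → κ → κ → ℝ) (q : κ → ℝ) (hq : ∀ i, 0 < q i)
    (hsymm : ∀ r i j, s r i j = s r j i)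
    (htri : ∀ r r' i j k, s r i j * s r' j k - s r' i j * s r j k
      + (s r j k * s r' k i - s r' j k * s r k i) + (s r k i * s r' i j - s r' k i * s r i j) = 0)
    (hind : ∀ c : ι → ℝ, (∀ i j, i ≠ j → ∑ r, c r * s r i j = 0) → c = 0) :
    ∃ ρ : κ → ℝ, ∑ i, q i * ρ i = 0 ∧
      ∀ c : ι → ℝ, (∀ i, ∑ r, c r * ∑ j, s r i j * q j * (ρ i - ρ j) = 0) → c = 0 := by
  classical
  -- These are the Laplacians conjugated by `√q`, which makes them symmetric for the standard inner
  -- product.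
  let A : ι → Matrix κ κ ℝ := fun r =>
    Matrix.diagonal (fun i => ∑ j, s r i j * q j) - Matrix.of fun i j => s r i j * (√(q i) * √(q j))
  let T : ι → Module.End ℝ (EuclideanSpace ℝ κ) := fun r => Matrix.toEuclideanLin (A r)
  have hsq : ∀ i, √(q i) * √(q i) = q i := fun i => Real.mul_self_sqrt (hq i).le
  have hpos : ∀ i, √(q i) ≠ 0 := fun i => (Real.sqrt_pos.2 (hq i)).ne'
  have hTapp : ∀ r v i, T r v i = ∑ j, s r i j * (q j * v i - √(q i) * √(q j) * v j) := by
    intro r v i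
    simp only [T, A, Matrix.toLpLin_apply, Matrix.sub_mulVec, Pi.sub_apply,
      Matrix.mulVec_diagonal]
    simp only [Matrix.mulVec, dotProduct, Matrix.of_apply, Finset.sum_mul, ← Finset.sum_sub_distrib]
    exact Finset.sum_congr rfl fun j _ => by ring
  have hAs : ∀ r, (T r).IsSymmetric := fun r => by
    rw [Matrix.isSymmetric_toEuclideanLin_iff]
    ext i j
    by_cases hij : i = j
    · subst hij; simp [A]
    · simp [A, hij, Ne.symm hij, hsymm r i j, mul_comm √(q i)]
  have hAc : ∀ r r', A r * A r' = A r' * A r := fun r r' => by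
    simp only [A, Matrix.sub_mul, Matrix.mul_sub]
    ext i k
    simp only [Matrix.sub_apply, Matrix.diagonal_mul_diagonal, Matrix.of_apply, Matrix.diagonal_apply,
      Matrix.mul_apply, mul_ite, ite_mul, mul_zero, zero_mul, Finset.sum_ite_eq,
      Finset.sum_ite_eq', Finset.mem_univ, if_true]
    -- Entry `(i, k)` of the commutator is a sum over `j` of the cyclic identity `htri` weighted by
    -- `q j`.
    have key : ∑ j, (s r i j * (√(q i) * √(q j)) * (s r' j k * (√(q j) * √(q k)))
        - s r' i j * (√(q i) * √(q j)) * (s r j k * (√(q j) * √(q k))))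
        = √(q i) * √(q k) * (s r' i k * ∑ j, s r i j * q j - s r i k * ∑ j, s r' i j * q j
          + (s r i k * ∑ j, s r' k j * q j - s r' i k * ∑ j, s r k j * q j)) := by
      simp only [Finset.mul_sum, ← Finset.sum_add_distrib, ← Finset.sum_sub_distrib]
      refine Finset.sum_congr rfl fun j _ => ?_
      have := htri r r' i j k
      rw [hsymm r k i, hsymm r' k i] at this
      rw [hsymm r k j, hsymm r' k j]
      linear_combination (√(q i) * √(q k) * q j) * this + √(q i) * √(q k)
        * (s r i j * s r' j k - s r' i j * s r j k) * hsq j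
    rw [Finset.sum_sub_distrib] at key
    by_cases hik : i = k
    · subst hik
      simp only [if_true]
      linear_combination key
    · simp only [hik, if_false] at key ⊢
      linear_combination key
  have hTc : ∀ r r', Commute (T r) (T r') := fun r r' => by
    show T r * T r' = T r' * T r
    ext v i
    have := congrArg (fun B => Matrix.mulVec B v.ofLp i) (hAc r r')
    simpa [T, Matrix.toLpLin_apply, ← Matrix.mulVec_mulVec] using this
  have hTi : LinearIndependent ℝ T := Fintype.linearIndependent_iff.2 fun c hc => by
    refine congrFun (hind c fun i j hij => ?_)
    have h1 := congrArg (fun v : EuclideanSpace ℝ κ => v i)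
      (LinearMap.congr_fun hc (EuclideanSpace.single j (1 : ℝ)))
    simp only [LinearMap.sum_apply, LinearMap.smul_apply] at h1
    rw [WithLp.ofLp_sum, Finset.sum_apply] at h1
    simp only [PiLp.smul_apply, hTapp, smul_eq_mul] at h1
    simp [hij] at h1
    have h2 : (√(q i) * √(q j)) * ∑ r, c r * s r i j = 0 := by
      rw [Finset.mul_sum, ← h1]
      refine Finset.sum_congr rfl fun r _ => by ring
    exact (mul_eq_zero.1 h2).resolve_left (mul_ne_zero (hpos i) (hpos j))
  obtain ⟨v, hv⟩ := exists_linearIndependent_apply T hAs hTc hTi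
  rcases isEmpty_or_nonempty κ with hκ | ⟨⟨i₀⟩⟩
  · exact ⟨fun _ => 0, by simp, fun c _ => hind c fun i => isEmptyElim i⟩
  have hQ : ∑ i, q i ≠ 0 := (Finset.sum_pos (fun i _ => hq i) ⟨i₀, Finset.mem_univ _⟩).ne'
  -- Dividing by `√q` undoes the conjugation. Subtracting the weighted mean achieves `∑ qᵢ ρᵢ = 0`
  -- and is harmless, since the Laplacians only see differences of `ρ`.
  refine ⟨fun i => v i / √(q i) - (∑ j, q j * (v j / √(q j))) / ∑ j, q j, ?_, fun c hc => ?_⟩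
  · simp only [mul_sub, Finset.sum_sub_distrib, ← Finset.sum_mul]
    field_simp
    simp
  · refine funext (Fintype.linearIndependent_iff.1 hv c ?_)
    ext i
    rw [WithLp.ofLp_sum, Finset.sum_apply]
    simp only [PiLp.smul_apply, hTapp, smul_eq_mul, PiLp.zero_apply]
    rw [← mul_zero (√(q i)), ← hc i, Finset.mul_sum]
    refine Finset.sum_congr rfl fun r _ => ?_
    rw [Finset.mul_sum, Finset.mul_sum, Finset.mul_sum]
    refine Finset.sum_congr rfl fun j _ => ?_
    have := hpos i
    have := hpos j
    have h1 : √(q i) * (v i / √(q i)) = v i := by field_simp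
    have h2 : q j * (v j / √(q j)) = √(q j) * v j := by
      rw [← hsq j]; simp; field_simp
    linear_combination (-(c r * s r i j * q j)) * h1 + c r * s r i j * √(q i) * h2

end LinearAlgebra

/-! ### Null sets: regular zero sets and degeneracy of affine families. -/

section NullSets

variable {E F : Type*} [NormedAddCommGroup E] [NormedSpace ℝ E] [FiniteDimensional ℝ E]
  [MeasurableSpace E] [BorelSpace E] (μ : Measure E) [μ.IsAddHaarMeasure]

/-- The zero set of a real function along which the differential does not vanish is a null set. -/
theorem measure_regular_zero_set {s : Set E} {h : E → ℝ} {h' : E → E →L[ℝ] ℝ}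
    (hd : ∀ x ∈ s, h x = 0 → HasFDerivAt h (h' x) x) (hreg : ∀ x ∈ s, h x = 0 → h' x ≠ 0) :
    μ {x ∈ s | h x = 0} = 0 := by
  have hu : ∀ x, ∃ u, h' x ≠ 0 → h' x u = 1 := fun x => by
    by_cases hx : h' x = 0
    · exact ⟨0, fun h => absurd hx h⟩
    · obtain ⟨u, hu⟩ := DFunLike.ne_iff.1 hx
      exact ⟨(h' x u)⁻¹ • u, fun _ => by simpa using inv_mul_cancel₀ hu⟩
  choose u hu using hu
  -- On the zero set the identity coincides with `y ↦ y - h y • u x`, whose derivative at `x` kills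
  -- `u x`. Sard's lemma then says that the image of the zero set under the identity is null.
  have key := addHaar_image_eq_zero_of_det_fderivWithin_eq_zero μ (f := id)
    (s := {x ∈ s | h x = 0}) (f' := fun x => ContinuousLinearMap.id ℝ E - (h' x).smulRight (u x))
    (fun x hx => ?_) (fun x hx => ?_)
  · simpa using key
  · have h1 : HasFDerivAt (fun y => id y - h y • u x)
        (ContinuousLinearMap.id ℝ E - (h' x).smulRight (u x)) x :=
      (hasFDerivAt_id x).sub ((hd x hx.1 hx.2).smul_const (u x))
    exact h1.hasFDerivWithinAt.congr (fun y hy => by simp [hy.2]) (by simp [hx.2])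
  · by_contra hdet
    have hne : h' x ≠ 0 := hreg x hx.1 hx.2
    have h1 := hu x hne
    have hker : (ContinuousLinearMap.id ℝ E - (h' x).smulRight (u x)).toLinearMap (u x) = 0 := by
      simp [h1]
    have hinj := (LinearMap.equivOfDetNeZero _ hdet).injective
    have h0 : u x = 0 := hinj (hker.trans (map_zero _).symm)
    rw [h0, map_zero] at h1
    exact zero_ne_one h1

variable [NormedAddCommGroup F] [InnerProductSpace ℝ F]

/-- A finite family of vectors depending affinely on a real parameter is linearly independent for
all but finitely many values of the parameter if it is so for one value. -/
theorem finite_not_linearIndependent_line {ι : Type*} [Fintype ι] (a b : ι → F)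
    (ha : LinearIndependent ℝ a) :
    {t : ℝ | ¬ LinearIndependent ℝ fun i => a i + t • b i}.Finite := by
  classical
  -- The Gram determinant is a polynomial in `t`, nonzero at `t = 0`, and independence holds
  -- wherever it does not vanish.
  let G : Matrix ι ι (Polynomial ℝ) := fun i j =>
    Polynomial.C (inner ℝ (a i) (a j))
      + Polynomial.C (inner ℝ (a i) (b j) + inner ℝ (b i) (a j)) * Polynomial.X
      + Polynomial.C (inner ℝ (b i) (b j)) * Polynomial.X ^ 2
  have heval : ∀ t : ℝ, (Polynomial.eval t G.det)
      = (Matrix.gram ℝ fun i => a i + t • b i).det := fun t => by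
    have := (Polynomial.evalRingHom t).map_det G
    rw [Polynomial.coe_evalRingHom] at this
    rw [this]
    congr 1
    ext i j
    rw [RingHom.mapMatrix_apply, Matrix.map_apply]
    simp [G, Matrix.gram_apply, inner_add_left, inner_add_right, inner_smul_left,
      inner_smul_right]
    ring
  have hdet : ∀ v : ι → F, (Matrix.gram ℝ v).det ≠ 0 → LinearIndependent ℝ v := fun v hv => by
    rw [Fintype.linearIndependent_iff]
    intro c hc
    have h1 : Matrix.mulVec (Matrix.gram ℝ v) c = 0 := by
      ext i
      simp only [Matrix.mulVec, dotProduct, Matrix.gram_apply, Pi.zero_apply]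
      rw [← inner_zero_right (𝕜 := ℝ) (v i), ← hc, inner_sum]
      exact Finset.sum_congr rfl fun j _ => by rw [inner_smul_right, mul_comm]
    exact congrFun (Matrix.eq_zero_of_mulVec_eq_zero hv h1)
  have hne : G.det ≠ 0 := fun h0 => by
    have h1 := heval 0
    rw [h0] at h1
    simp only [Polynomial.eval_zero, zero_smul, add_zero] at h1
    obtain ⟨c, hc0, hc⟩ := Matrix.exists_mulVec_eq_zero_iff.2 h1.symm
    refine hc0 (funext (Fintype.linearIndependent_iff.1 ha c ?_))
    rw [← inner_self_eq_zero (𝕜 := ℝ), sum_inner]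
    refine Finset.sum_eq_zero fun i _ => ?_
    rw [inner_smul_left, inner_sum]
    have := congrFun hc i
    simp only [Matrix.mulVec, dotProduct, Matrix.gram_apply, Pi.zero_apply] at this
    rw [← mul_zero ((starRingEnd ℝ) (c i)), ← this]
    exact congrArg _ (Finset.sum_congr rfl fun j _ => by rw [inner_smul_right, mul_comm])
  refine (Polynomial.finite_setOfPred_isRoot hne).subset fun t ht => ?_
  by_contra hr
  refine ht (hdet _ ?_)
  rwa [← heval]

/-- A finite family of vectors depending affinely on `p` is linearly independent for almost every
`p` if it is so for one `p`. -/
theorem ae_linearIndependent_affine {ι : Type*} [Fintype ι] (a : ι → F) (b : ι → E →L[ℝ] F)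
    (p₀ : E) (h : LinearIndependent ℝ fun i => a i + b i p₀) :
    ∀ᵐ p ∂μ, LinearIndependent ℝ fun i => a i + b i p := by
  classical
  let g : E → (ι → F) := fun p i => a i + b i p
  have hg : Continuous g := by fun_prop
  let Z : Set E := {p | ¬ LinearIndependent ℝ (g p)}
  have hZc : IsClosed Z := by
    have : IsOpen {v : ι → F | LinearIndependent ℝ v} := isOpen_setOfPred_linearIndependent
    exact (this.preimage hg).isClosed_compl
  let c : ℝ → E → E := fun t p => p₀ + t • (p - p₀)
  have hS : MeasurableSet {q : E × ℝ | c q.2 q.1 ∈ Zᶜ} :=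
    (hZc.isOpen_compl.preimage (by fun_prop : Continuous fun q : E × ℝ => c q.2 q.1)).measurableSet
  have h1 : ∀ᵐ p ∂μ, ∀ᵐ t : ℝ, c t p ∈ Zᶜ := Filter.Eventually.of_forall fun p => by
    have hfin := finite_not_linearIndependent_line (fun i => a i + b i p₀) (fun i => b i (p - p₀)) h
    refine measure_eq_zero_iff_ae_notMem.1 (measure_mono_null (fun t ht => ?_)
      (hfin.measure_zero volume)) |>.mono fun t ht => Set.mem_compl ht
    have hgc : g (c t p) = fun i => a i + b i p₀ + t • b i (p - p₀) := by
      ext i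
      simp only [g, c, map_add, map_smul, add_assoc]
    show ¬ LinearIndependent ℝ (fun i => a i + b i p₀ + t • b i (p - p₀))
    rw [← hgc]
    exact ht
  -- On each line through `p₀` almost every parameter is good. By Fubini some homothety of nonzero
  -- ratio `t` about `p₀` sends almost every `p` to a good point, and such a homothety preserves
  -- null sets in both directions.
  have h2 := (Measure.ae_ae_comm (ν := volume) hS).1 h1
  have h3 : ∀ᵐ t : ℝ, t ≠ 0 := by simp [ae_iff]
  obtain ⟨t, ht, ht0⟩ := (h2.and h3).exists
  have h4 : μ (c t ⁻¹' Z) = 0 := measure_eq_zero_iff_ae_notMem.2 ht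
  have h5 : c t ⁻¹' Z = (fun p => p + -p₀) ⁻¹' ((fun p => t • p) ⁻¹' ((fun p => p₀ + p) ⁻¹' Z)) := by
    ext p
    simp [c, sub_eq_add_neg]
  rw [h5, measure_preimage_add_right, Measure.addHaar_preimage_smul μ ht0,
    measure_preimage_add] at h4
  have h6 := (mul_eq_zero.1 h4).resolve_left (by simp [ht0, abs_pos])
  exact (measure_eq_zero_iff_ae_notMem.1 h6).mono fun p hp => not_not.1 hp

end NullSets

/-! ### Functions of angular momenta and their canonical brackets. -/

section QuadraticIntegrals

variable {ι : Type*}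

/-- The angular momentum in the coordinate plane `(a, b)`. -/
def angularMomentum (y z : ι → ℝ) (a b : ι) : ℝ := y a * z b - y b * z a

theorem angularMomentum_antisymm (y z : ι → ℝ) (a b : ι) :
    angularMomentum y z a b = - angularMomentum y z b a := by
  unfold angularMomentum; ring

variable [Fintype ι]

/-- The function `¼ ∑ σₐᵦ Mₐᵦ² + ½ ∑ uₐ yₐ² + ½ ∑ τₐᵦ Mₐᵦ` of position and momentum, where
`M` is the angular momentum. -/
noncomputable def momentumEnergy (σ τ : ι → ι → ℝ) (u : ι → ℝ) (y z : ι → ℝ) : ℝ :=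
  1 / 4 * ∑ a, ∑ b, σ a b * angularMomentum y z a b ^ 2 + 1 / 2 * ∑ a, u a * y a ^ 2
    + 1 / 2 * ∑ a, ∑ b, τ a b * angularMomentum y z a b

/-- The gradient of `momentumEnergy` with respect to the momentum. -/
def gradMomentum (σ τ : ι → ι → ℝ) (y z : ι → ℝ) (c : ι) : ℝ :=
  ∑ a, (σ a c * angularMomentum y z a c + τ a c) * y a

/-- The gradient of `momentumEnergy` with respect to the position. -/
def gradPosition (σ τ : ι → ι → ℝ) (u : ι → ℝ) (y z : ι → ℝ) (c : ι) : ℝ :=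
  u c * y c - ∑ a, (σ a c * angularMomentum y z a c + τ a c) * z a

/-- Permuting the summation indices does not change the sum, so six times it is the sum of the
symmetrization. This reduces the triple sums in the bracket to one identity per triple of indices.
-/
theorem sum_eq_zero_of_symmetrization (W : ι → ι → ι → ℝ)
    (h : ∀ a b c, W a b c + W b a c + W b c a + W c b a + W c a b + W a c b = 0) :
    ∑ a, ∑ b, ∑ c, W a b c = 0 := by
  have h1 : ∑ a, ∑ b, ∑ c, W b a c = ∑ a, ∑ b, ∑ c, W a b c := Finset.sum_comm
  have h2 : ∑ a, ∑ b, ∑ c, W a c b = ∑ a, ∑ b, ∑ c, W a b c :=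
    Finset.sum_congr rfl fun a _ => Finset.sum_comm
  have h3 : ∑ a, ∑ b, ∑ c, W c a b = ∑ a, ∑ b, ∑ c, W a b c :=
    (Finset.sum_congr rfl fun a _ => Finset.sum_comm).trans h1
  have h4 : ∑ a, ∑ b, ∑ c, W b c a = ∑ a, ∑ b, ∑ c, W a b c := Finset.sum_comm.trans h2
  have h5 : ∑ a, ∑ b, ∑ c, W c b a = ∑ a, ∑ b, ∑ c, W a b c :=
    (Finset.sum_congr rfl fun a _ => Finset.sum_comm).trans h4
  have h6 : ∑ a, ∑ b, ∑ c, (W a b c + W b a c + W b c a + W c b a + W c a b + W a c b) = 0 :=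
    Finset.sum_eq_zero fun a _ => Finset.sum_eq_zero fun b _ => Finset.sum_eq_zero fun c _ =>
      h a b c
  simp only [Finset.sum_add_distrib, h1, h2, h3, h4, h5] at h6
  linarith

theorem sum_eq_zero_of_antisymm (W : ι → ι → ℝ) (h : ∀ a b, W a b + W b a = 0) :
    ∑ a, ∑ b, W a b = 0 := by
  have h1 : ∑ a, ∑ b, W b a = ∑ a, ∑ b, W a b := Finset.sum_comm
  have h2 : ∑ a, ∑ b, (W a b + W b a) = 0 :=
    Finset.sum_eq_zero fun a _ => Finset.sum_eq_zero fun b _ => h a b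
  simp only [Finset.sum_add_distrib, h1] at h2
  linarith

/-- Angular momenta generate rotations, so the velocity generated by such a function is tangent to
the sphere. This is what allows brackets to be computed in the ambient space. -/
theorem sum_mul_gradMomentum {σ τ : ι → ι → ℝ} (hσ : ∀ a b, σ a b = σ b a)
    (hτ : ∀ a b, τ a b = - τ b a) (y z : ι → ℝ) : ∑ c, y c * gradMomentum σ τ y z c = 0 := by
  simp only [gradMomentum, Finset.mul_sum]
  refine sum_eq_zero_of_antisymm _ fun a b => ?_
  rw [hσ a b, hτ a b, angularMomentum_antisymm y z a b]
  ring

/-- The canonical Poisson bracket of two functions of the form `momentumEnergy`. -/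
theorem bracket_momentumEnergy {σ τ σ' τ' : ι → ι → ℝ} {u u' : ι → ℝ}
    (hσ : ∀ a b, σ a b = σ b a) (hσ' : ∀ a b, σ' a b = σ' b a)
    (hτ : ∀ a b, τ a b = - τ b a) (hτ' : ∀ a b, τ' a b = - τ' b a)
    (hu : ∀ a b, σ a b * (u' a - u' b) = σ' a b * (u a - u b))
    (htri : ∀ a b c, σ a b * σ' b c - σ' a b * σ b c + (σ b c * σ' c a - σ' b c * σ c a)
      + (σ c a * σ' a b - σ' c a * σ a b) = 0)
    (hτσ : ∀ a b c, τ a c * (σ' b a - σ' b c) = 0) (hτu : ∀ a c, τ a c * (u' a - u' c) = 0)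
    (hτσ' : ∀ a b c, τ' a c * (σ b a - σ b c) = 0) (hτu' : ∀ a c, τ' a c * (u a - u c) = 0)
    (hττ : ∀ a b c, τ' a c * τ b c = τ a c * τ' b c) (y z : ι → ℝ) :
    ∑ c, (gradPosition σ' τ' u' y z c * gradMomentum σ τ y z c
      - gradPosition σ τ u y z c * gradMomentum σ' τ' y z c) = 0 := by
  let A : ι → ι → ℝ := fun a c => σ a c * angularMomentum y z a c + τ a c
  let B : ι → ι → ℝ := fun a c => σ' a c * angularMomentum y z a c + τ' a c
  have e1 : ∑ c, (gradPosition σ' τ' u' y z c * gradMomentum σ τ y z c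
      - gradPosition σ τ u y z c * gradMomentum σ' τ' y z c)
      = ∑ c, ∑ b, (u' c * A b c - u c * B b c) * (y b * y c)
        + ∑ c, ∑ a, ∑ b, (A a c * B b c - B a c * A b c) * (z a * y b) := by
    rw [← Finset.sum_add_distrib]
    refine Finset.sum_congr rfl fun c _ => ?_
    have e2 : ∑ a, ∑ b, (A a c * B b c - B a c * A b c) * (z a * y b)
        = (∑ a, A a c * z a) * (∑ b, B b c * y b) - (∑ a, B a c * z a) * (∑ b, A b c * y b) := by
      simp only [Finset.sum_mul_sum, ← Finset.sum_sub_distrib]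
      exact Finset.sum_congr rfl fun a _ => Finset.sum_congr rfl fun b _ => by ring
    have e3 : ∑ b, (u' c * A b c - u c * B b c) * (y b * y c)
        = u' c * y c * (∑ b, A b c * y b) - u c * y c * (∑ b, B b c * y b) := by
      simp only [Finset.mul_sum, ← Finset.sum_sub_distrib]
      exact Finset.sum_congr rfl fun b _ => by ring
    rw [e2, e3]
    simp only [gradPosition, gradMomentum]
    show _ * (∑ b, A b c * y b) - _ * (∑ b, B b c * y b) = _
    ring
  rw [e1, sum_eq_zero_of_antisymm, sum_eq_zero_of_symmetrization, add_zero]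
  · intro c a b
    simp only [A, B]
    rw [hσ c a, hσ b a, hσ c b, hσ' c a, hσ' b a, hσ' c b, hτ c a, hτ b a, hτ c b, hτ' c a,
      hτ' b a, hτ' c b, angularMomentum_antisymm y z c a, angularMomentum_antisymm y z b a,
      angularMomentum_antisymm y z c b]
    have t0 := htri a b c
    have t1 := hτσ a c b
    have t2 := hτσ b a c
    have t3 := hτσ a b c
    have t1' := hτσ' a c b
    have t2' := hτσ' b a c
    have t3' := hτσ' a b c
    have r1 := hττ a b c
    have r2 := hττ b c a
    have r3 := hττ a c b
    simp only [hσ c a, hσ b a, hσ c b, hσ' c a, hσ' b a, hσ' c b] at t0 t1 t2 t3 t1' t2' t3'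
    rw [hτ b a, hτ c a, hτ' b a, hτ' c a] at r2
    rw [hτ c b, hτ' c b] at r3
    obtain ⟨m1, hm1⟩ : ∃ m, m = angularMomentum y z a b := ⟨_, rfl⟩
    obtain ⟨m2, hm2⟩ : ∃ m, m = angularMomentum y z b c := ⟨_, rfl⟩
    obtain ⟨m3, hm3⟩ : ∃ m, m = angularMomentum y z a c := ⟨_, rfl⟩
    rw [← hm1, ← hm2, ← hm3]
    simp only [angularMomentum] at hm1 hm2 hm3
    have key : ((σ a c * m3 + τ a c) * (σ' b c * m2 + τ' b c)
          - (σ' a c * m3 + τ' a c) * (σ b c * m2 + τ b c)) * m1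
        + ((σ a b * m1 + τ a b) * (σ' a c * m3 + τ' a c)
          - (σ' a b * m1 + τ' a b) * (σ a c * m3 + τ a c)) * m2
        + ((σ b c * m2 + τ b c) * (σ' a b * m1 + τ' a b)
          - (σ' b c * m2 + τ' b c) * (σ a b * m1 + τ a b)) * m3 = 0 := by
      linear_combination (-(m1 * m2 * m3)) * t0 - m1 * m2 * t3 + m1 * m3 * t2 + m2 * m3 * t1
        + m1 * m2 * t3' - m1 * m3 * t2' - m2 * m3 * t1' - m1 * r1 - m2 * r2 - m3 * r3
    rw [hm1, hm2, hm3] at key ⊢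
    linear_combination -key
  · intro c b
    simp only [A, B]
    rw [hσ c b, hσ' c b, hτ c b, hτ' c b, angularMomentum_antisymm y z c b]
    have h1 := hu b c
    have h2 := hτu b c
    have h3 := hτu' b c
    linear_combination (-(angularMomentum y z b c * (y b * y c))) * h1 - (y b * y c) * h2
      + (y b * y c) * h3

/-- Expansion of `momentumEnergy` in the momentum. -/
theorem momentumEnergy_add {σ τ : ι → ι → ℝ} (u : ι → ℝ) (hσ : ∀ a b, σ a b = σ b a)
    (hτ : ∀ a b, τ a b = - τ b a) (y z ζ : ι → ℝ) :
    momentumEnergy σ τ u y (z + ζ) = 1 / 4 * ∑ a, ∑ b, σ a b * angularMomentum y ζ a b ^ 2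
      + ∑ c, gradMomentum σ τ y z c * ζ c + momentumEnergy σ τ u y z := by
  have h : ∑ c, gradMomentum σ τ y z c * ζ c
      = 1 / 2 * ∑ a, ∑ b, (σ a b * angularMomentum y z a b + τ a b) * angularMomentum y ζ a b := by
    rw [Finset.sum_comm, ← sub_eq_zero, Finset.mul_sum, ← Finset.sum_sub_distrib]
    simp only [gradMomentum, Finset.sum_mul, Finset.mul_sum, ← Finset.sum_sub_distrib]
    refine sum_eq_zero_of_antisymm _ fun a b => ?_
    rw [hσ a b, hτ a b, angularMomentum_antisymm y z a b]
    simp only [angularMomentum]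
    ring
  rw [h]
  have hadd : ∀ a b, angularMomentum y (z + ζ) a b
      = angularMomentum y z a b + angularMomentum y ζ a b := fun a b => by
    simp only [angularMomentum, Pi.add_apply]; ring
  have h2 : ∑ a, ∑ b, σ a b * angularMomentum y (z + ζ) a b ^ 2
      + 2 * ∑ a, ∑ b, τ a b * angularMomentum y (z + ζ) a b
      = ∑ a, ∑ b, σ a b * angularMomentum y z a b ^ 2
      + 2 * ∑ a, ∑ b, (σ a b * angularMomentum y z a b + τ a b) * angularMomentum y ζ a b
      + ∑ a, ∑ b, σ a b * angularMomentum y ζ a b ^ 2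
      + 2 * ∑ a, ∑ b, τ a b * angularMomentum y z a b := by
    simp only [Finset.mul_sum, ← Finset.sum_add_distrib, hadd]
    exact Finset.sum_congr rfl fun a _ => Finset.sum_congr rfl fun b _ => by ring
  simp only [momentumEnergy]
  linear_combination 1 / 4 * h2

theorem gradient_pairing {σ τ : ι → ι → ℝ} (u : ι → ℝ) (hσ : ∀ a b, σ a b = σ b a)
    (hτ : ∀ a b, τ a b = - τ b a) (y z y' z' : ι → ℝ) :
    ∑ c, (gradPosition σ τ u y z c * y' c + gradMomentum σ τ y z c * z' c)
      = ∑ a, u a * y a * y' a + 1 / 2 * ∑ a, ∑ b, (σ a b * angularMomentum y z a b + τ a b)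
        * (y a * z' b + z b * y' a - (y b * z' a + z a * y' b)) := by
  have h : ∑ c, (gradPosition σ τ u y z c * y' c + gradMomentum σ τ y z c * z' c)
      = ∑ a, u a * y a * y' a + ∑ c, ∑ a, (σ a c * angularMomentum y z a c + τ a c)
        * (y a * z' c - z a * y' c) := by
    rw [← Finset.sum_add_distrib]
    refine Finset.sum_congr rfl fun c _ => ?_
    simp only [gradPosition, gradMomentum, sub_mul, Finset.sum_mul, mul_sub,
      Finset.sum_sub_distrib, mul_assoc]
    ring
  rw [h, add_right_inj, Finset.sum_comm, ← sub_eq_zero, Finset.mul_sum, ← Finset.sum_sub_distrib]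
  simp only [Finset.mul_sum, ← Finset.sum_sub_distrib]
  refine sum_eq_zero_of_antisymm _ fun a b => ?_
  rw [hσ a b, hτ a b, angularMomentum_antisymm y z a b]
  ring

theorem hasFDerivAt_momentumEnergy {V : Type*} [NormedAddCommGroup V] [NormedSpace ℝ V]
    {σ τ : ι → ι → ℝ} (u : ι → ℝ) (hσ : ∀ a b, σ a b = σ b a)
    (hτ : ∀ a b, τ a b = - τ b a) {Y Z : V → ι → ℝ} {Y' Z' : ι → V →L[ℝ] ℝ} {t : V}
    (hY : ∀ a, HasFDerivAt (fun s => Y s a) (Y' a) t)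
    (hZ : ∀ a, HasFDerivAt (fun s => Z s a) (Z' a) t) :
    HasFDerivAt (fun s => momentumEnergy σ τ u (Y s) (Z s))
      (∑ c, (gradPosition σ τ u (Y t) (Z t) c • Y' c + gradMomentum σ τ (Y t) (Z t) c • Z' c)) t := by
  let M' : ι → ι → V →L[ℝ] ℝ := fun a b =>
    Y t a • Z' b + Z t b • Y' a - (Y t b • Z' a + Z t a • Y' b)
  have hM : ∀ a b, HasFDerivAt (fun s => angularMomentum (Y s) (Z s) a b) (M' a b) t :=
    fun a b => ((hY a).mul (hZ b)).sub ((hY b).mul (hZ a))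
  have h1 : HasFDerivAt (fun s => momentumEnergy σ τ u (Y s) (Z s)) _ t :=
    (((HasFDerivAt.fun_sum fun a _ => HasFDerivAt.fun_sum fun b _ =>
      ((hM a b).pow 2).const_mul (σ a b)).const_mul (1 / 4)).add
    ((HasFDerivAt.fun_sum fun a _ => ((hY a).pow 2).const_mul (u a)).const_mul (1 / 2))).add
    ((HasFDerivAt.fun_sum fun a _ => HasFDerivAt.fun_sum fun b _ =>
      (hM a b).const_mul (τ a b)).const_mul (1 / 2))
  refine h1.congr_fderiv ?_
  ext v
  have h2 := gradient_pairing u hσ hτ (Y t) (Z t) (fun c => Y' c v) (fun c => Z' c v)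
  simp only [sum_apply, add_apply, smul_apply, M', sub_apply, smul_eq_mul, nsmul_eq_mul] at h2 ⊢
  rw [h2]
  have h3 : ∀ (m : ι → ι → ℝ) (d : ι → ℝ),
      1 / 4 * ∑ a, ∑ b, σ a b * (((2 : ℕ) : ℝ) * angularMomentum (Y t) (Z t) a b ^ (2 - 1) * m a b)
        + 1 / 2 * ∑ a, u a * (((2 : ℕ) : ℝ) * Y t a ^ (2 - 1) * d a)
        + 1 / 2 * ∑ a, ∑ b, τ a b * m a b
      = ∑ a, u a * Y t a * d a + 1 / 2 * ∑ a, ∑ b,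
        (σ a b * angularMomentum (Y t) (Z t) a b + τ a b) * m a b := fun m d => by
    simp only [Finset.mul_sum, ← Finset.sum_add_distrib]
    refine Finset.sum_congr rfl fun a _ => ?_
    rw [add_right_comm, ← Finset.sum_add_distrib, add_comm]
    congr 1
    · push_cast; ring
    · exact Finset.sum_congr rfl fun b _ => by push_cast; ring
  exact h3 _ _

end QuadraticIntegrals

section CommutingPencil

variable {d : ℕ}

/-- A representative of the level set of `b` through `i`. -/
noncomputable def levelRep (b : Fin (d + 1) → ℝ) (i : Fin (d + 1)) : Fin (d + 1) :=
  Function.invFun b (b i)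

theorem apply_levelRep (b : Fin (d + 1) → ℝ) (i : Fin (d + 1)) : b (levelRep b i) = b i :=
  Function.invFun_eq ⟨i, rfl⟩

theorem levelRep_congr {b : Fin (d + 1) → ℝ} {i j : Fin (d + 1)} (h : b i = b j) :
    levelRep b i = levelRep b j := by
  rw [levelRep, levelRep, h]

/-- Divided differences of `v` with respect to `b`, resolved by the index inside the level sets
of `b`. -/
noncomputable def resolvedDifference (b v : Fin (d + 1) → ℝ) (i j : Fin (d + 1)) : ℝ :=
  if b i = b j then (v i - v j) / ((i : ℝ) - (j : ℝ))
  else (v (levelRep b i) - v (levelRep b j)) / (b i - b j)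

theorem resolvedDifference_symm (b v : Fin (d + 1) → ℝ) (i j : Fin (d + 1)) :
    resolvedDifference b v i j = resolvedDifference b v j i := by
  unfold resolvedDifference
  by_cases h : b i = b j
  · rw [if_pos h, if_pos h.symm, ← neg_sub (v j), ← neg_sub (j : ℝ), neg_div_neg_eq]
  · rw [if_neg h, if_neg (Ne.symm h), ← neg_sub (v (levelRep b j)), ← neg_sub (b j),
      neg_div_neg_eq]

theorem resolvedDifference_self (b v : Fin (d + 1) → ℝ) (i : Fin (d + 1)) :
    resolvedDifference b v i i = 0 := by
  simp [resolvedDifference]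

theorem resolvedDifference_sum {ι : Type*} [Fintype ι] (b : Fin (d + 1) → ℝ) (c : ι → ℝ)
    (v : ι → Fin (d + 1) → ℝ) (i j : Fin (d + 1)) :
    resolvedDifference b (∑ r, c r • v r) i j = ∑ r, c r * resolvedDifference b (v r) i j := by
  unfold resolvedDifference
  split_ifs <;>
  · simp only [Finset.sum_apply, Pi.smul_apply, smul_eq_mul, ← Finset.sum_sub_distrib,
      Finset.sum_div, ← mul_sub, mul_div_assoc]

theorem eq_of_resolvedDifference_eq_zero {b v : Fin (d + 1) → ℝ}
    (h : ∀ i j, i ≠ j → resolvedDifference b v i j = 0) (i j : Fin (d + 1)) : v i = v j := by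
  have hsub : ∀ i j, b i = b j → v i = v j := fun i j hb => by
    by_cases hij : i = j
    · rw [hij]
    · have h1 := h i j hij
      rw [resolvedDifference, if_pos hb, div_eq_zero_iff] at h1
      refine sub_eq_zero.1 (h1.resolve_right fun h2 => hij (Fin.ext ?_))
      exact_mod_cast sub_eq_zero.1 h2
  by_cases hb : b i = b j
  · exact hsub i j hb
  · have h1 := h i j (fun hij => hb (by rw [hij]))
    rw [resolvedDifference, if_neg hb, div_eq_zero_iff] at h1
    have h2 := sub_eq_zero.1 (h1.resolve_right (sub_ne_zero.2 hb))
    rw [← hsub _ i (apply_levelRep b i), h2, hsub _ j (apply_levelRep b j)]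

theorem dividedDifference_cyclic (x y z x' y' z' : ℝ) {p q r : ℝ} (hpq : p ≠ q) (hqr : q ≠ r)
    (hrp : r ≠ p) :
    (x - y) / (p - q) * ((y' - z') / (q - r)) - (x' - y') / (p - q) * ((y - z) / (q - r))
      + ((y - z) / (q - r) * ((z' - x') / (r - p)) - (y' - z') / (q - r) * ((z - x) / (r - p)))
      + ((z - x) / (r - p) * ((x' - y') / (p - q)) - (z' - x') / (r - p) * ((x - y) / (p - q)))
      = 0 := by
  have h1 := sub_ne_zero.2 hpq
  have h2 := sub_ne_zero.2 hqr
  have h3 := sub_ne_zero.2 hrp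
  field_simp
  ring

theorem resolvedDifference_cyclic (b v v' : Fin (d + 1) → ℝ) (i j k : Fin (d + 1)) :
    resolvedDifference b v i j * resolvedDifference b v' j k
        - resolvedDifference b v' i j * resolvedDifference b v j k
      + (resolvedDifference b v j k * resolvedDifference b v' k i
        - resolvedDifference b v' j k * resolvedDifference b v k i)
      + (resolvedDifference b v k i * resolvedDifference b v' i j
        - resolvedDifference b v' k i * resolvedDifference b v i j) = 0 := by
  by_cases hij : i = j
  · subst hij
    simp only [resolvedDifference_self, resolvedDifference_symm b _ k i]
    ring
  by_cases hjk : j = k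
  · subst hjk
    simp only [resolvedDifference_self, resolvedDifference_symm b _ j i]
    ring
  by_cases hki : k = i
  · subst hki
    simp only [resolvedDifference_self, resolvedDifference_symm b _ k j]
    ring
  have hne : ∀ i j : Fin (d + 1), i ≠ j → (i : ℝ) ≠ (j : ℝ) := fun i j h h' =>
    h (Fin.ext (by exact_mod_cast h'))
  have hcongr : ∀ (w : Fin (d + 1) → ℝ) (i j k : Fin (d + 1)), b i = b j → b i ≠ b k →
      resolvedDifference b w i k = resolvedDifference b w j k := fun w i j k h h' => by
    rw [resolvedDifference, resolvedDifference, if_neg h', if_neg (h ▸ h'), levelRep_congr h, h]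
  by_cases h1 : b i = b j
  · by_cases h2 : b j = b k
    · simp only [resolvedDifference, if_pos h1, if_pos h2, if_pos (h1.trans h2).symm]
      exact dividedDifference_cyclic _ _ _ _ _ _ (hne _ _ hij) (hne _ _ hjk) (hne _ _ hki)
    · simp only [resolvedDifference_symm b _ k i, hcongr _ i j k h1 (h1 ▸ h2)]
      ring
  · by_cases h2 : b j = b k
    · simp only [resolvedDifference_symm b _ i j, hcongr _ j k i h2 (Ne.symm h1)]
      ring
    · by_cases h3 : b k = b i
      · simp only [resolvedDifference_symm b _ j k, hcongr _ k i j h3 (Ne.symm h2)]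
        ring
      · simp only [resolvedDifference, if_neg h1, if_neg h2, if_neg h3]
        exact dividedDifference_cyclic _ _ _ _ _ _ h1 h2 h3

/-- The potential differences are proportional to the weights `resolvedDifference`. -/
theorem levelRep_sub (b v : Fin (d + 1) → ℝ) (i j : Fin (d + 1)) :
    v (levelRep b i) - v (levelRep b j) = resolvedDifference b v i j * (b i - b j) := by
  by_cases h : b i = b j
  · rw [levelRep_congr h, h]; ring
  · rw [resolvedDifference, if_neg h, div_mul_cancel₀ _ (sub_ne_zero.2 h)]

/-- For arbitrary (possibly coinciding) frequencies `b`, there are as many commuting pairs of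
weights `s` and potentials `u` as there are indices minus one, starting with `(1, b)`. -/
theorem exists_commuting_weights (k : ℕ) (b : Fin (k + 2) → ℝ) :
    ∃ (s : Fin (k + 1) → Fin (k + 2) → Fin (k + 2) → ℝ) (u : Fin (k + 1) → Fin (k + 2) → ℝ),
      (s 0 = fun _ _ => 1) ∧ u 0 = b ∧ (∀ r i j, s r i j = s r j i) ∧
      (∀ r r' i j k, s r i j * s r' j k - s r' i j * s r j k
        + (s r j k * s r' k i - s r' j k * s r k i)
        + (s r k i * s r' i j - s r' k i * s r i j) = 0) ∧
      (∀ r r' i j, s r i j * (u r' i - u r' j) = s r' i j * (u r i - u r j)) ∧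
      ∀ c : Fin (k + 1) → ℝ, (∀ i j, i ≠ j → ∑ r, c r * s r i j = 0) → c = 0 := by
  let v₀ : Fin (k + 2) → ℝ := fun i => b i + ((i : ℝ) - (levelRep b i : ℝ))
  have hrep : ∀ i, levelRep b (levelRep b i) = levelRep b i := fun i =>
    levelRep_congr (apply_levelRep b i)
  have hv₀ : ∀ i j, i ≠ j → resolvedDifference b v₀ i j = 1 := fun i j hij => by
    by_cases h : b i = b j
    · have : (i : ℝ) - (j : ℝ) ≠ 0 := sub_ne_zero.2 fun h' => hij (Fin.ext (by exact_mod_cast h'))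
      rw [resolvedDifference, if_pos h]
      simp only [v₀]
      rw [h, levelRep_congr h, div_eq_one_iff_eq this]
      ring
    · rw [resolvedDifference, if_neg h, div_eq_one_iff_eq (sub_ne_zero.2 h)]
      simp only [v₀, hrep, apply_levelRep]
      ring
  have hpair : LinearIndependent ℝ ![(fun _ => 1 : Fin (k + 2) → ℝ), v₀] := by
    rw [LinearIndependent.pair_iff]
    intro s t hst
    have h0 := congrFun hst
    simp only [Pi.add_apply, Pi.smul_apply, smul_eq_mul, mul_one, Pi.zero_apply] at h0
    have ht : t = 0 := by
      by_contra ht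
      have hconst : ∀ i, v₀ i = -s / t := fun i => by
        rw [eq_div_iff ht]; linarith [h0 i]
      have h1 := hv₀ 0 1 (by simp)
      simp [resolvedDifference, hconst] at h1
    refine ⟨?_, ht⟩
    simpa [ht] using h0 0
  obtain ⟨g, hg, hg0, hg1⟩ := exists_linearIndependent_extending_pair hpair k (by simp)
  let w : Fin k → Fin (k + 2) → ℝ := fun r => g r.succ.succ
  refine ⟨Fin.cons (fun _ _ => 1) fun r => resolvedDifference b (w r),
    Fin.cons b fun r i => w r (levelRep b i), rfl, rfl, ?_, ?_, ?_, fun c hc => ?_⟩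
  · intro r i j
    refine Fin.cases ?_ (fun r => ?_) r
    · rfl
    · exact resolvedDifference_symm _ _ _ _
  · intro r r' i j l
    refine Fin.cases ?_ (fun r => ?_) r <;> refine Fin.cases ?_ (fun r' => ?_) r' <;>
      simp only [Fin.cons_zero, Fin.cons_succ]
    · ring
    · ring
    · ring
    · exact resolvedDifference_cyclic _ _ _ _ _ _
  · intro r r' i j
    refine Fin.cases ?_ (fun r => ?_) r <;> refine Fin.cases ?_ (fun r' => ?_) r' <;>
      simp only [Fin.cons_zero, Fin.cons_succ, levelRep_sub]
    · ring
    · ring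
    · ring
  · have h1 : ∀ i j, i ≠ j → resolvedDifference b (∑ r, c r • g r.succ) i j = 0 :=
      fun i j hij => by
        rw [resolvedDifference_sum, ← hc i j hij, Fin.sum_univ_succ, Fin.sum_univ_succ]
        have : g (Fin.succ 0) = v₀ := hg1
        rw [this, hv₀ i j hij]
        rfl
    have h2 := eq_of_resolvedDifference_eq_zero h1
    have h3 : ∑ r, (Fin.cons (-(∑ r, c r • g r.succ) 0) c : Fin (k + 2) → ℝ) r • g r = 0 := by
      rw [Fin.sum_univ_succ]
      simp only [Fin.cons_zero, Fin.cons_succ, hg0]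
      ext i
      simp only [Pi.add_apply, Pi.smul_apply, smul_eq_mul, mul_one, Pi.zero_apply]
      rw [h2 i 0]
      ring
    have h4 := Fintype.linearIndependent_iff.1 hg _ h3
    ext r
    simpa using h4 r.succ

end CommutingPencil

section DualLift

variable {E F : Type*} [NormedAddCommGroup E] [InnerProductSpace ℝ E]
  [NormedAddCommGroup F] [InnerProductSpace ℝ F] [FiniteDimensional ℝ F]

/-- The bilinear form induced on `E` by a linear map to a Euclidean space. -/
noncomputable def inducedForm (T : E →L[ℝ] F) : E →L[ℝ] E →L[ℝ] ℝ :=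
  ((ContinuousLinearMap.compL ℝ E F ℝ).flip T).comp
    ((LinearMap.toContinuousBilinearMap (innerₗ F)).comp T)

theorem inducedForm_apply (T : E →L[ℝ] F) (u v : E) :
    inducedForm T u v = inner ℝ (T u) (T v) := rfl

/-- The vector in the range of an injective map `T` that represents a linear form on `E`. -/
noncomputable def dualLift (T : E →L[ℝ] F) (p : E →L[ℝ] ℝ) : F :=
  T ((inducedForm T).inverse p)

theorem dualLift_add (T : E →L[ℝ] F) (p q : E →L[ℝ] ℝ) :
    dualLift T (p + q) = dualLift T p + dualLift T q := by
  simp [dualLift]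

theorem dualLift_smul (T : E →L[ℝ] F) (c : ℝ) (p : E →L[ℝ] ℝ) :
    dualLift T (c • p) = c • dualLift T p := by
  simp [dualLift]

variable [FiniteDimensional ℝ E]

/-- The induced form of an injective map as an isomorphism onto the dual. -/
theorem exists_inducedForm_equiv {T : E →L[ℝ] F} (hT : Function.Injective T) :
    ∃ e : E ≃L[ℝ] (E →L[ℝ] ℝ), (e : E →L[ℝ] E →L[ℝ] ℝ) = inducedForm T := by
  have hinj : Function.Injective (inducedForm T) := by
    rw [injective_iff_map_eq_zero]
    intro u hu
    have := inducedForm_apply T u u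
    rw [hu] at this
    exact hT (by rw [map_zero]; exact inner_self_eq_zero.1 this.symm)
  have hdim : Module.finrank ℝ E = Module.finrank ℝ (E →L[ℝ] ℝ) :=
    (InnerProductSpace.toDual ℝ E).toLinearEquiv.finrank_eq
  refine ⟨(LinearEquiv.ofInjectiveOfFinrankEq _ hinj hdim).toContinuousLinearEquiv, ?_⟩
  ext u v
  rfl

theorem inner_dualLift {T : E →L[ℝ] F} (hT : Function.Injective T) (p : E →L[ℝ] ℝ) (u : E) :
    inner ℝ (dualLift T p) (T u) = p u := by
  obtain ⟨e, he⟩ := exists_inducedForm_equiv hT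
  rw [dualLift, ← inducedForm_apply, ← he, ContinuousLinearMap.inverse_equiv]
  simp

theorem contDiffOn_dualLift {V : Type*} [NormedAddCommGroup V] [NormedSpace ℝ V] {s : Set V}
    {T : V → E →L[ℝ] F} {p : V → E →L[ℝ] ℝ} {k : WithTop ℕ∞} (hT : ContDiffOn ℝ k T s)
    (hp : ContDiffOn ℝ k p s) (hinj : ∀ z ∈ s, Function.Injective (T z)) :
    ContDiffOn ℝ k (fun z => dualLift (T z) (p z)) s := by
  have h1 : ContDiffOn ℝ k (fun z => inducedForm (T z)) s := by
    unfold inducedForm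
    exact (((ContinuousLinearMap.compL ℝ E F ℝ).flip.contDiff.comp_contDiffOn hT)).clm_comp
      (contDiffOn_const.clm_comp hT)
  have h2 : ContDiffOn ℝ k (fun z => (inducedForm (T z)).inverse) s := fun z hz => by
    obtain ⟨e, he⟩ := exists_inducedForm_equiv (hinj z hz)
    have := contDiffAt_map_inverse (n := k) e
    rw [he] at this
    exact this.comp_contDiffWithinAt z (h1 z hz)
  exact hT.clm_apply (h2.clm_apply hp)

end DualLift

section SphereGeometry

variable {n : ℕ}

local notation "𝔼" k => EuclideanSpace ℝ (Fin k)

theorem range_inclusionDeriv (x : Sphere n) (v : 𝔼 (n + 1)) :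
    (∃ u, inclusionDeriv x u = v) ↔ inner ℝ (x : 𝔼 (n + 1)) v = 0 := by
  have := Fact.mk (@finrank_euclideanSpace_fin ℝ _ (n + 1))
  have h : (inclusionDeriv x).range = (ℝ ∙ (x : 𝔼 (n + 1)))ᗮ := range_mvfderiv_subtypeVal x
  rw [← Submodule.mem_orthogonal_singleton_iff_inner_right, ← h]
  exact LinearMap.mem_range.symm

theorem inclusionDeriv_injective (x : Sphere n) : Function.Injective (inclusionDeriv x) := by
  have := Fact.mk (@finrank_euclideanSpace_fin ℝ _ (n + 1))
  exact injective_mvfderiv_subtypeVal_sphere x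

/-- The tangent vector to the sphere that represents a covector with respect to the metric. -/
noncomputable def velocity (ξ : CotangentBundle (n := n) (Sphere n)) : 𝔼 (n + 1) :=
  dualLift (E := 𝔼 n) (inclusionDeriv ξ.proj) ξ.snd

theorem inner_velocity (ξ : CotangentBundle (n := n) (Sphere n))
    (u : TangentSpace (𝓡 n) ξ.proj) :
    inner ℝ (velocity ξ) (inclusionDeriv ξ.proj u) = ξ.snd u :=
  inner_dualLift (E := 𝔼 n) (inclusionDeriv_injective ξ.proj) ξ.snd u

theorem inner_velocity_self (ξ : CotangentBundle (n := n) (Sphere n)) :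
    inner ℝ (ξ.proj : 𝔼 (n + 1)) (velocity ξ) = 0 :=
  (range_inclusionDeriv ξ.proj _).1 ⟨_, rfl⟩

/-- Tangent vectors to the sphere are determined by their products with tangent vectors. -/
theorem eq_of_inner_inclusionDeriv {x : Sphere n} {v w : 𝔼 (n + 1)}
    (hv : inner ℝ (x : 𝔼 (n + 1)) v = 0) (hw : inner ℝ (x : 𝔼 (n + 1)) w = 0)
    (h : ∀ u, inner ℝ v (inclusionDeriv x u) = inner ℝ w (inclusionDeriv x u)) : v = w := by
  obtain ⟨u, hu⟩ := (range_inclusionDeriv x (v - w)).2 (by rw [inner_sub_right, hv, hw, sub_zero])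
  rw [← sub_eq_zero, ← inner_self_eq_zero (𝕜 := ℝ)]
  nth_rewrite 2 [← hu]
  rw [inner_sub_left, h u, sub_self]

/-- A point of the sphere in a local coordinate system, as a vector. -/
def position (e : OpenPartialHomeomorph (Sphere n) (𝔼 n)) (x : 𝔼 n) : 𝔼 (n + 1) := e.symm x

variable {e : OpenPartialHomeomorph (Sphere n) (𝔼 n)}

theorem contDiffOn_position
    (he : e ∈ IsManifold.maximalAtlas (𝓡 n) ∞ (Sphere n)) : ContDiffOn ℝ ∞ (position e) e.target := by
  have := Fact.mk (@finrank_euclideanSpace_fin ℝ _ (n + 1))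
  have h : ContMDiff (𝓡 n) 𝓘(ℝ, 𝔼 (n + 1)) ∞ ((↑) : Sphere n → 𝔼 (n + 1)) := contMDiff_coe_sphere
  exact (h.comp_contMDiffOn (contMDiffOn_symm_of_mem_maximalAtlas he)).contDiffOn

theorem mdifferentiable_chart
    (he : e ∈ IsManifold.maximalAtlas (𝓡 n) ∞ (Sphere n)) : e.MDifferentiable (𝓡 n) (𝓡 n) :=
  ⟨(contMDiffOn_of_mem_maximalAtlas he).mdifferentiableOn (by simp),
    (contMDiffOn_symm_of_mem_maximalAtlas he).mdifferentiableOn (by simp)⟩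

theorem fderiv_position
    (he : e ∈ IsManifold.maximalAtlas (𝓡 n) ∞ (Sphere n))
    {x : 𝔼 n} (hx : x ∈ e.target) (u : 𝔼 n) :
    fderiv ℝ (position e) x u
      = inclusionDeriv (e.symm x) (mfderiv (𝓡 n) (𝓡 n) e.symm x u) := by
  have := Fact.mk (@finrank_euclideanSpace_fin ℝ _ (n + 1))
  have h : ContMDiff (𝓡 n) 𝓘(ℝ, 𝔼 (n + 1)) ∞ ((↑) : Sphere n → 𝔼 (n + 1)) := contMDiff_coe_sphere
  have h1 : MDifferentiableAt (𝓡 n) 𝓘(ℝ, 𝔼 (n + 1)) ((↑) : Sphere n → 𝔼 (n + 1)) (e.symm x) :=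
    h.mdifferentiable (by simp) _
  have h2 := (mdifferentiable_chart he).mdifferentiableAt_symm hx
  have h3 := mfderiv_comp x h1 h2
  rw [← mfderiv_eq_fderiv]
  exact DFunLike.congr_fun h3 u

theorem range_fderiv_position
    (he : e ∈ IsManifold.maximalAtlas (𝓡 n) ∞ (Sphere n))
    {x : 𝔼 n} (hx : x ∈ e.target) (v : 𝔼 (n + 1)) :
    (∃ u, fderiv ℝ (position e) x u = v) ↔ inner ℝ (position e x) v = 0 := by
  rw [position, ← range_inclusionDeriv]
  constructor
  · rintro ⟨u, rfl⟩
    exact ⟨_, (fderiv_position he hx u).symm⟩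
  · rintro ⟨u, rfl⟩
    refine ⟨mfderiv (𝓡 n) (𝓡 n) e (e.symm x) u, ?_⟩
    refine (fderiv_position he hx _).trans (congrArg _ ?_)
    have := (mdifferentiable_chart he).symm_comp_deriv (e.map_target hx)
    rw [e.right_inv hx] at this
    exact DFunLike.congr_fun this u

theorem fderiv_position_injective
    (he : e ∈ IsManifold.maximalAtlas (𝓡 n) ∞ (Sphere n))
    {x : 𝔼 n} (hx : x ∈ e.target) :
    Function.Injective (fderiv ℝ (position e) x) := by
  rw [injective_iff_map_eq_zero]
  intro u hu
  rw [fderiv_position he hx] at hu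
  have h1 : mfderiv (𝓡 n) (𝓡 n) e.symm x u = 0 :=
    inclusionDeriv_injective _ (hu.trans (map_zero _).symm)
  have h2 := DFunLike.congr_fun ((mdifferentiable_chart he).comp_symm_deriv hx) u
  have h3 : u = mfderiv (𝓡 n) (𝓡 n) e (e.symm x) (mfderiv (𝓡 n) (𝓡 n) e.symm x u) := h2.symm
  rw [h3, h1]
  exact map_zero _

theorem velocity_canonicalCoord
    (he : e ∈ IsManifold.maximalAtlas (𝓡 n) ∞ (Sphere n))
    {z : (𝔼 n) × (𝔼 n)} (hz : z.1 ∈ e.target) :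
    velocity (canonicalCoord e z) = dualLift (fderiv ℝ (position e) z.1) (innerSL ℝ z.2) := by
  refine eq_of_inner_inclusionDeriv (x := e.symm z.1) (inner_velocity_self _)
    ((range_fderiv_position he hz _).1 ⟨_, rfl⟩) fun u => ?_
  obtain ⟨u', hu'⟩ := (range_fderiv_position he hz (inclusionDeriv (e.symm z.1) u)).2
    ((range_inclusionDeriv _ _).1 ⟨u, rfl⟩)
  rw [← hu', inner_dualLift (fderiv_position_injective he hz), fderiv_position he hz]
  refine (inner_velocity (canonicalCoord e z) _).trans ?_
  exact congrArg (innerSL ℝ z.2)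
    (DFunLike.congr_fun ((mdifferentiable_chart he).comp_symm_deriv hz) u')

theorem contDiffOn_velocity
    (he : e ∈ IsManifold.maximalAtlas (𝓡 n) ∞ (Sphere n)) :
    ContDiffOn ℝ ∞ (fun z => velocity (canonicalCoord e z)) (e.target ×ˢ Set.univ) := by
  have h1 : ContDiffOn ℝ ∞ (fderiv ℝ (position e)) e.target :=
    (contDiffOn_position he).fderiv_of_isOpen e.open_target (by simp)
  have h2 : ContDiffOn ℝ ∞ (fun z : (𝔼 n) × (𝔼 n) =>
      dualLift (fderiv ℝ (position e) z.1)
        ((LinearMap.toContinuousBilinearMap (innerₗ (𝔼 n))) z.2)) (e.target ×ˢ Set.univ) :=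
    contDiffOn_dualLift (h1.comp contDiffOn_fst fun z hz => hz.1)
      ((ContinuousLinearMap.contDiff _).comp contDiff_snd).contDiffOn
      fun z hz => fderiv_position_injective he hz.1
  exact h2.congr fun z hz => velocity_canonicalCoord he hz.1

end SphereGeometry

section CanonicalEmbedding

variable {n : ℕ}

local notation "𝔼" k => EuclideanSpace ℝ (Fin k)

/-- The velocity shifted by the vector potential `K x`. -/
noncomputable def gaugedMomentum (K : (𝔼 (n + 1)) →L[ℝ] 𝔼 (n + 1))
    (ξ : CotangentBundle (n := n) (Sphere n)) : 𝔼 (n + 1) :=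
  velocity ξ + K (ξ.proj : 𝔼 (n + 1))

variable {e : OpenPartialHomeomorph (Sphere n) (𝔼 n)} {K : (𝔼 (n + 1)) →L[ℝ] 𝔼 (n + 1)}

theorem hasFDerivAt_position (he : e ∈ IsManifold.maximalAtlas (𝓡 n) ∞ (Sphere n)) {x : 𝔼 n}
    (hx : x ∈ e.target) : HasFDerivAt (position e) (fderiv ℝ (position e) x) x :=
  (((contDiffOn_position he).contDiffAt (e.open_target.mem_nhds hx)).differentiableAt
    (by simp)).hasFDerivAt

theorem hasFDerivAt_position_fst (he : e ∈ IsManifold.maximalAtlas (𝓡 n) ∞ (Sphere n))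
    {z : (𝔼 n) × 𝔼 n} (hz : z.1 ∈ e.target) :
    HasFDerivAt (fun z : (𝔼 n) × 𝔼 n => position e z.1)
      ((fderiv ℝ (position e) z.1).comp (ContinuousLinearMap.fst ℝ (𝔼 n) (𝔼 n))) z :=
  (hasFDerivAt_position he hz).comp z hasFDerivAt_fst

theorem contDiffOn_gaugedMomentum (he : e ∈ IsManifold.maximalAtlas (𝓡 n) ∞ (Sphere n)) :
    ContDiffOn ℝ ∞ (fun z => gaugedMomentum K (canonicalCoord e z)) (e.target ×ˢ Set.univ) :=
  (contDiffOn_velocity he).add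
    (K.contDiff.comp_contDiffOn ((contDiffOn_position he).comp contDiffOn_fst fun _ hz => hz.1))

theorem prod_target_mem_nhds {z : (𝔼 n) × 𝔼 n} (hz : z.1 ∈ e.target) :
    e.target ×ˢ Set.univ ∈ nhds z :=
  (e.open_target.prod isOpen_univ).mem_nhds ⟨hz, trivial⟩

theorem hasFDerivAt_velocity (he : e ∈ IsManifold.maximalAtlas (𝓡 n) ∞ (Sphere n))
    {z : (𝔼 n) × 𝔼 n} (hz : z.1 ∈ e.target) :
    HasFDerivAt (fun z => velocity (canonicalCoord e z))
      (fderiv ℝ (fun z => velocity (canonicalCoord e z)) z) z :=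
  (((contDiffOn_velocity he).contDiffAt (prod_target_mem_nhds hz)).differentiableAt
    (by simp)).hasFDerivAt

theorem hasFDerivAt_gaugedMomentum (he : e ∈ IsManifold.maximalAtlas (𝓡 n) ∞ (Sphere n))
    {z : (𝔼 n) × 𝔼 n} (hz : z.1 ∈ e.target) :
    HasFDerivAt (fun z => gaugedMomentum K (canonicalCoord e z))
      (fderiv ℝ (fun z => velocity (canonicalCoord e z)) z
        + K.comp ((fderiv ℝ (position e) z.1).comp (ContinuousLinearMap.fst ℝ (𝔼 n) (𝔼 n)))) z :=
  (hasFDerivAt_velocity he hz).add (K.hasFDerivAt.comp z (hasFDerivAt_position_fst he hz))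

theorem inner_velocity_canonicalCoord (he : e ∈ IsManifold.maximalAtlas (𝓡 n) ∞ (Sphere n))
    {z : (𝔼 n) × 𝔼 n} (hz : z.1 ∈ e.target) (u : 𝔼 n) :
    inner ℝ (velocity (canonicalCoord e z)) (fderiv ℝ (position e) z.1 u) = inner ℝ z.2 u := by
  rw [velocity_canonicalCoord he hz, inner_dualLift (fderiv_position_injective he hz)]
  rfl

theorem inner_fderiv_velocity (he : e ∈ IsManifold.maximalAtlas (𝓡 n) ∞ (Sphere n))
    {z : (𝔼 n) × 𝔼 n} (hz : z.1 ∈ e.target) (η : (𝔼 n) × 𝔼 n) (u : 𝔼 n) :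
    inner ℝ (fderiv ℝ (fun z => velocity (canonicalCoord e z)) z η)
        (fderiv ℝ (position e) z.1 u)
      + inner ℝ (velocity (canonicalCoord e z)) (fderiv ℝ (fderiv ℝ (position e)) z.1 η.1 u)
      = inner ℝ η.2 u := by
  have h1 : HasFDerivAt (fderiv ℝ (position e)) (fderiv ℝ (fderiv ℝ (position e)) z.1) z.1 :=
    ((((contDiffOn_position he).fderiv_of_isOpen e.open_target (m := ∞) (by simp)).contDiffAt
      (e.open_target.mem_nhds hz)).differentiableAt (by simp)).hasFDerivAt
  have h2 : HasFDerivAt (fun z : (𝔼 n) × 𝔼 n => fderiv ℝ (position e) z.1 u)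
      _ z := (h1.comp z hasFDerivAt_fst).clm_apply (hasFDerivAt_const u z)
  have h3 := (hasFDerivAt_velocity he hz).inner ℝ h2
  have h4 : HasFDerivAt (fun z : (𝔼 n) × 𝔼 n => inner ℝ z.2 u) _ z :=
    (hasFDerivAt_snd (p := z)).inner ℝ (hasFDerivAt_const u z)
  have h5 := h3.congr_of_eventuallyEq
    (Filter.eventually_of_mem (prod_target_mem_nhds hz) fun w hw =>
      (inner_velocity_canonicalCoord he hw.1 u).symm)
  have h6 := DFunLike.congr_fun (h5.unique h4) η
  simp [fderivInnerCLM_apply] at h6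
  linarith

/-- The perturbed symplectic form is the pull back of the canonical one by the position and the
gauged momentum. -/
theorem perturbedForm_eq (he : e ∈ IsManifold.maximalAtlas (𝓡 n) ∞ (Sphere n))
    {α : (𝔼 (n + 1)) [⋀^Fin 2]→L[ℝ] ℝ} (hα : ∀ a b, α ![a, b] = 2 * inner ℝ (K a) b)
    (hK : ∀ a b, inner ℝ (K a) b = - inner ℝ a (K b))
    {z : (𝔼 n) × 𝔼 n} (hz : z.1 ∈ e.target) (X Y : (𝔼 n) × 𝔼 n) :
    perturbedForm (constantMagneticForm α) e z.1 X Y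
      = inner ℝ (fderiv ℝ (fun z => gaugedMomentum K (canonicalCoord e z)) z X)
          (fderiv ℝ (position e) z.1 Y.1)
        - inner ℝ (fderiv ℝ (fun z => gaugedMomentum K (canonicalCoord e z)) z Y)
          (fderiv ℝ (position e) z.1 X.1) := by
  have h1 : constantMagneticForm α (e.symm z.1)
      ![mfderiv (𝓡 n) (𝓡 n) e.symm z.1 X.1, mfderiv (𝓡 n) (𝓡 n) e.symm z.1 Y.1]
      = 2 * inner ℝ (K (fderiv ℝ (position e) z.1 X.1)) (fderiv ℝ (position e) z.1 Y.1) := by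
    rw [← hα, fderiv_position he hz, fderiv_position he hz]
    refine congrArg α ?_
    ext i
    fin_cases i <;> rfl
  have h2 := inner_fderiv_velocity he hz X Y.1
  have h3 := inner_fderiv_velocity he hz Y X.1
  have hsymm : fderiv ℝ (fderiv ℝ (position e)) z.1 X.1 Y.1
      = fderiv ℝ (fderiv ℝ (position e)) z.1 Y.1 X.1 :=
    ((contDiffOn_position he).contDiffAt (e.open_target.mem_nhds hz)).isSymmSndFDerivAt
      (by rw [minSmoothness_of_isRCLikeNormedField]; exact WithTop.coe_le_coe.2 (le_top : (2 : ℕ∞) ≤ ⊤)) X.1 Y.1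
  have h4 : ∑ i, (X.2 i * Y.1 i - Y.2 i * X.1 i) = inner ℝ X.2 Y.1 - inner ℝ Y.2 X.1 := by
    simp only [PiLp.inner_apply, ← Finset.sum_sub_distrib]
    exact Finset.sum_congr rfl fun i _ => by simp [mul_comm]
  rw [perturbedForm, h1, h4, (hasFDerivAt_gaugedMomentum he hz).fderiv]
  simp only [add_apply, ContinuousLinearMap.comp_apply, ContinuousLinearMap.coe_fst',
    inner_add_left]
  rw [hK (fderiv ℝ (position e) z.1 Y.1), real_inner_comm (K _) (fderiv ℝ (position e) z.1 Y.1)]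
  rw [hsymm] at h2
  linarith

/-- Hamiltonian vectors of functions of the position and the gauged momentum. -/
theorem IsHamiltonianVector.fderiv_position
    (he : e ∈ IsManifold.maximalAtlas (𝓡 n) ∞ (Sphere n))
    {α : (𝔼 (n + 1)) [⋀^Fin 2]→L[ℝ] ℝ} (hα : ∀ a b, α ![a, b] = 2 * inner ℝ (K a) b)
    (hK : ∀ a b, inner ℝ (K a) b = - inner ℝ a (K b))
    {z : (𝔼 n) × 𝔼 n} (hz : z.1 ∈ e.target) {F : CotangentBundle (n := n) (Sphere n) → ℝ}
    {P Q : 𝔼 (n + 1)} (hQ : inner ℝ (position e z.1) Q = 0)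
    (hF : ∀ η, fderiv ℝ (F ∘ canonicalCoord e) z η = inner ℝ P (fderiv ℝ (position e) z.1 η.1)
      + inner ℝ Q (fderiv ℝ (fun z => gaugedMomentum K (canonicalCoord e z)) z η))
    {X : (𝔼 n) × 𝔼 n} (hX : IsHamiltonianVector (constantMagneticForm α) F e z X) :
    fderiv ℝ (position e) z.1 X.1 = - Q ∧
    ∀ u, inner ℝ (fderiv ℝ (fun z => gaugedMomentum K (canonicalCoord e z)) z X)
      (fderiv ℝ (position e) z.1 u) = inner ℝ P (fderiv ℝ (position e) z.1 u) := by
  have hX' : ∀ Y, _ := fun Y => (perturbedForm_eq he hα hK hz X Y).symm.trans ((hX Y).trans (hF Y))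
  have h1 : fderiv ℝ (position e) z.1 X.1 = - Q := by
    obtain ⟨u, hu⟩ := (range_fderiv_position he hz (fderiv ℝ (position e) z.1 X.1 + Q)).2 (by
      rw [inner_add_right, hQ, add_zero]
      exact (range_fderiv_position he hz _).1 ⟨_, rfl⟩)
    have h2 := hX' (0, u)
    have h3 := inner_fderiv_velocity he hz (0, u) u
    rw [hu, inner_add_right] at h3
    simp only [(hasFDerivAt_gaugedMomentum he hz).fderiv, add_apply,
      ContinuousLinearMap.comp_apply, ContinuousLinearMap.coe_fst', map_zero, inner_zero_right,
      add_zero, zero_apply] at h2 h3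
    rw [real_inner_comm _ Q] at h2
    have h4 : inner ℝ u u = 0 := by linarith
    rw [inner_self_eq_zero.1 h4, map_zero] at hu
    exact eq_neg_of_add_eq_zero_left hu.symm
  refine ⟨h1, fun u => ?_⟩
  have h2 := hX' (u, 0)
  simp only [h1, inner_neg_right] at h2
  rw [real_inner_comm _ Q] at h2
  linarith

theorem perturbedForm_hamiltonian
    (he : e ∈ IsManifold.maximalAtlas (𝓡 n) ∞ (Sphere n))
    {α : (𝔼 (n + 1)) [⋀^Fin 2]→L[ℝ] ℝ} (hα : ∀ a b, α ![a, b] = 2 * inner ℝ (K a) b)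
    (hK : ∀ a b, inner ℝ (K a) b = - inner ℝ a (K b))
    {z : (𝔼 n) × 𝔼 n} (hz : z.1 ∈ e.target) {F G : CotangentBundle (n := n) (Sphere n) → ℝ}
    {P Q P' Q' : 𝔼 (n + 1)} (hQ : inner ℝ (position e z.1) Q = 0)
    (hQ' : inner ℝ (position e z.1) Q' = 0)
    (hF : ∀ η, fderiv ℝ (F ∘ canonicalCoord e) z η = inner ℝ P (fderiv ℝ (position e) z.1 η.1)
      + inner ℝ Q (fderiv ℝ (fun z => gaugedMomentum K (canonicalCoord e z)) z η))
    (hG : ∀ η, fderiv ℝ (G ∘ canonicalCoord e) z η = inner ℝ P' (fderiv ℝ (position e) z.1 η.1)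
      + inner ℝ Q' (fderiv ℝ (fun z => gaugedMomentum K (canonicalCoord e z)) z η))
    {X Y : (𝔼 n) × 𝔼 n} (hX : IsHamiltonianVector (constantMagneticForm α) F e z X)
    (hY : IsHamiltonianVector (constantMagneticForm α) G e z Y) :
    perturbedForm (constantMagneticForm α) e z.1 X Y = inner ℝ P' Q - inner ℝ P Q' := by
  obtain ⟨h1, -⟩ := hX.fderiv_position he hα hK hz hQ hF
  obtain ⟨h2, h3⟩ := hY.fderiv_position he hα hK hz hQ' hG
  have h4 := h3 X.1
  rw [h1, inner_neg_right, inner_neg_right, neg_inj] at h4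
  rw [hX Y, hF, h2, inner_neg_right, real_inner_comm _ Q, h4]
  ring

/-- The function on `T*Sⁿ` given by `momentumEnergy` of the coordinates of the position and of the
gauged momentum in an orthonormal basis. -/
noncomputable def sphereIntegral (f : OrthonormalBasis (Fin (n + 1)) ℝ (𝔼 (n + 1)))
    (K : (𝔼 (n + 1)) →L[ℝ] 𝔼 (n + 1)) (σ τ : Fin (n + 1) → Fin (n + 1) → ℝ) (u : Fin (n + 1) → ℝ)
    (ξ : CotangentBundle (n := n) (Sphere n)) : ℝ :=
  momentumEnergy σ τ u (fun a => inner ℝ (f a) (ξ.proj : 𝔼 (n + 1)))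
    (fun a => inner ℝ (f a) (gaugedMomentum K ξ))

variable {f : OrthonormalBasis (Fin (n + 1)) ℝ (𝔼 (n + 1))}
  {σ τ σ' τ' : Fin (n + 1) → Fin (n + 1) → ℝ} {u u' : Fin (n + 1) → ℝ}

theorem fderiv_sphereIntegral (he : e ∈ IsManifold.maximalAtlas (𝓡 n) ∞ (Sphere n))
    (hσ : ∀ a b, σ a b = σ b a) (hτ : ∀ a b, τ a b = - τ b a)
    {z : (𝔼 n) × 𝔼 n} (hz : z.1 ∈ e.target) (η : (𝔼 n) × 𝔼 n) :
    fderiv ℝ (sphereIntegral f K σ τ u ∘ canonicalCoord e) z η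
      = inner ℝ (∑ c, gradPosition σ τ u (fun a => inner ℝ (f a) (position e z.1))
          (fun a => inner ℝ (f a) (gaugedMomentum K (canonicalCoord e z))) c • f c)
          (fderiv ℝ (position e) z.1 η.1)
        + inner ℝ (∑ c, gradMomentum σ τ (fun a => inner ℝ (f a) (position e z.1))
          (fun a => inner ℝ (f a) (gaugedMomentum K (canonicalCoord e z))) c • f c)
          (fderiv ℝ (fun z => gaugedMomentum K (canonicalCoord e z)) z η) := by
  have h := hasFDerivAt_momentumEnergy u hσ hτ
    (Y := fun z : (𝔼 n) × 𝔼 n => fun a => inner ℝ (f a) (position e z.1))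
    (Z := fun z => fun a => inner ℝ (f a) (gaugedMomentum K (canonicalCoord e z)))
    (fun a => ((innerSL ℝ (f a)).hasFDerivAt).comp z (hasFDerivAt_position_fst he hz))
    (fun a => ((innerSL ℝ (f a)).hasFDerivAt).comp z
      (hasFDerivAt_gaugedMomentum (K := K) he hz).differentiableAt.hasFDerivAt)
  have h' : HasFDerivAt (sphereIntegral f K σ τ u ∘ canonicalCoord e) _ z := h
  rw [h'.fderiv]
  simp [sum_inner, inner_smul_left, Finset.sum_add_distrib]

theorem inner_sum_smul_basis (f : OrthonormalBasis (Fin (n + 1)) ℝ (𝔼 (n + 1)))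
    (g : Fin (n + 1) → ℝ) (v : 𝔼 (n + 1)) :
    inner ℝ v (∑ c, g c • f c) = ∑ c, inner ℝ (f c) v * g c := by
  rw [inner_sum]
  exact Finset.sum_congr rfl fun c _ => by rw [inner_smul_right, real_inner_comm, mul_comm]

theorem inner_sum_smul_sum_smul (f : OrthonormalBasis (Fin (n + 1)) ℝ (𝔼 (n + 1)))
    (g h : Fin (n + 1) → ℝ) :
    inner ℝ (∑ c, g c • f c) (∑ c, h c • f c) = ∑ c, g c * h c := by
  rw [f.orthonormal.inner_sum]
  simp

theorem poissonCommute_sphereIntegral {α : (𝔼 (n + 1)) [⋀^Fin 2]→L[ℝ] ℝ}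
    (hα : ∀ a b, α ![a, b] = 2 * inner ℝ (K a) b)
    (hK : ∀ a b, inner ℝ (K a) b = - inner ℝ a (K b))
    (hσ : ∀ a b, σ a b = σ b a) (hσ' : ∀ a b, σ' a b = σ' b a)
    (hτ : ∀ a b, τ a b = - τ b a) (hτ' : ∀ a b, τ' a b = - τ' b a)
    (hbr : ∀ y z, ∑ c, (gradPosition σ' τ' u' y z c * gradMomentum σ τ y z c
      - gradPosition σ τ u y z c * gradMomentum σ' τ' y z c) = 0) :
    PoissonCommute (constantMagneticForm α) (sphereIntegral f K σ τ u)
      (sphereIntegral f K σ' τ' u') := by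
  intro e he z hz X Y hX hY
  rw [perturbedForm_hamiltonian he hα hK hz ?_ ?_ (fderiv_sphereIntegral he hσ hτ hz)
    (fderiv_sphereIntegral he hσ' hτ' hz) hX hY, inner_sum_smul_sum_smul, inner_sum_smul_sum_smul,
    ← Finset.sum_sub_distrib]
  · exact hbr _ _
  · rw [inner_sum_smul_basis]
    exact sum_mul_gradMomentum hσ hτ _ _
  · rw [inner_sum_smul_basis]
    exact sum_mul_gradMomentum hσ' hτ' _ _

end CanonicalEmbedding

section Smoothness

variable {n : ℕ}

local notation "𝔼" k => EuclideanSpace ℝ (Fin k)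

theorem velocity_eq_dualLift {e : OpenPartialHomeomorph (Sphere n) (𝔼 n)}
    (he : e ∈ IsManifold.maximalAtlas (𝓡 n) ∞ (Sphere n))
    {ξ : CotangentBundle (n := n) (Sphere n)} (hξ : ξ.proj ∈ e.source) {p : (𝔼 n) →L[ℝ] ℝ}
    (hp : ∀ u : 𝔼 n, p u = ξ.snd (mfderiv (𝓡 n) (𝓡 n) e.symm (e ξ.proj) u)) :
    velocity ξ = dualLift (fderiv ℝ (position e) (e ξ.proj)) p := by
  have hx : e ξ.proj ∈ e.target := e.map_source hξ
  have hpos : position e (e ξ.proj) = ξ.proj := congrArg Subtype.val (e.left_inv hξ)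
  have hsymm : e.symm (e ξ.proj) = ξ.proj := e.left_inv hξ
  have hd : ∀ u : 𝔼 n, fderiv ℝ (position e) (e ξ.proj) u
      = inclusionDeriv ξ.proj (mfderiv (𝓡 n) (𝓡 n) e.symm (e ξ.proj) u) := fun u => by
    refine (fderiv_position he hx u).trans ?_
    have : ∀ (y : Sphere n) (w : 𝔼 n), y = ξ.proj →
        (inclusionDeriv y : (𝔼 n) →L[ℝ] 𝔼 (n + 1)) w
          = (inclusionDeriv ξ.proj : (𝔼 n) →L[ℝ] 𝔼 (n + 1)) w := by
      rintro y w rfl; rfl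
    exact this _ _ hsymm
  refine eq_of_inner_inclusionDeriv (x := ξ.proj) (inner_velocity_self ξ)
    (by rw [← hpos]; exact (range_fderiv_position he hx _).1 ⟨_, rfl⟩) fun u => ?_
  obtain ⟨u', hu'⟩ := (range_fderiv_position he hx (inclusionDeriv ξ.proj u)).2
    (by rw [hpos]; exact (range_inclusionDeriv _ _).1 ⟨u, rfl⟩)
  rw [← hu', inner_dualLift (fderiv_position_injective he hx), hd, hp]
  exact inner_velocity ξ _

theorem contMDiff_velocity :
    ContMDiff ((𝓡 n).prod 𝓘(ℝ, (𝔼 n) →L[ℝ] ℝ)) 𝓘(ℝ, 𝔼 (n + 1)) ∞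
      (velocity : CotangentBundle (n := n) (Sphere n) → 𝔼 (n + 1)) := by
  intro ξ₀
  obtain ⟨h1, h2⟩ := (contMDiffAt_hom_bundle (fun ξ : CotangentBundle (n := n) (Sphere n) => ξ)).1
    (contMDiffAt_id : ContMDiffAt ((𝓡 n).prod 𝓘(ℝ, (𝔼 n) →L[ℝ] ℝ))
      ((𝓡 n).prod 𝓘(ℝ, (𝔼 n) →L[ℝ] ℝ)) ∞ (fun ξ => ξ) ξ₀)
  let e := chartAt (𝔼 n) ξ₀.proj
  have he : e ∈ IsManifold.maximalAtlas (𝓡 n) ∞ (Sphere n) :=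
    IsManifold.chart_mem_maximalAtlas ξ₀.proj
  have hξ₀ : ξ₀.proj ∈ e.source := mem_chart_source _ _
  let P : CotangentBundle (n := n) (Sphere n) → (𝔼 n) →L[ℝ] ℝ := fun ξ =>
    ContinuousLinearMap.inCoordinates (𝔼 n) (TangentSpace (𝓡 n)) ℝ (fun _ => ℝ)
      ξ₀.proj ξ.proj ξ₀.proj ξ.proj ξ.snd
  have hP : ∀ ξ : CotangentBundle (n := n) (Sphere n), ξ.proj ∈ e.source →
      ∀ u : 𝔼 n, P ξ u = ξ.snd (mfderiv (𝓡 n) (𝓡 n) e.symm (e ξ.proj) u) := fun ξ hξ u => by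
    have h3 := TangentBundle.symmL_trivializationAt (𝕜 := ℝ) (I := 𝓡 n) (x₀ := ξ₀.proj) hξ
    simp only [mfld_simps, mfderivWithin_univ] at h3
    simp only [P, ContinuousLinearMap.inCoordinates]
    refine Eq.trans ?_ (congrArg ξ.snd (DFunLike.congr_fun h3 u))
    exact DFunLike.congr_fun
      (Bundle.Trivial.continuousLinearMapAt_trivialization ℝ (Sphere n) ℝ ξ.proj) _
  have h4 : ContMDiffAt ((𝓡 n).prod 𝓘(ℝ, (𝔼 n) →L[ℝ] ℝ)) 𝓘(ℝ, 𝔼 n) ∞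
      (fun ξ : CotangentBundle (n := n) (Sphere n) => e ξ.proj) ξ₀ :=
    (contMDiffAt_of_mem_maximalAtlas he hξ₀).comp ξ₀ h1
  have h5 : ContDiffOn ℝ ∞ (fun z : (𝔼 n) × ((𝔼 n) →L[ℝ] ℝ) =>
      dualLift (fderiv ℝ (position e) z.1) z.2) (e.target ×ˢ Set.univ) :=
    contDiffOn_dualLift (((contDiffOn_position he).fderiv_of_isOpen e.open_target (m := ∞)
      (by simp)).comp contDiffOn_fst fun z hz => hz.1) contDiffOn_snd
      fun z hz => fderiv_position_injective he hz.1
  have h6 : ContDiffAt ℝ ∞ (fun z : (𝔼 n) × ((𝔼 n) →L[ℝ] ℝ) =>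
      dualLift (fderiv ℝ (position e) z.1) z.2) (e ξ₀.proj, P ξ₀) :=
    h5.contDiffAt ((e.open_target.prod isOpen_univ).mem_nhds ⟨e.map_source hξ₀, trivial⟩)
  have h7 := (h6.contMDiffAt).comp ξ₀ (h4.prodMk_space h2)
  refine h7.congr_of_eventuallyEq ?_
  filter_upwards [h1.continuousAt.preimage_mem_nhds (e.open_source.mem_nhds hξ₀)] with ξ hξ
  exact velocity_eq_dualLift he hξ (hP ξ hξ)

theorem contMDiff_proj_coe :
    ContMDiff ((𝓡 n).prod 𝓘(ℝ, (𝔼 n) →L[ℝ] ℝ)) 𝓘(ℝ, 𝔼 (n + 1)) ∞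
      (fun ξ : CotangentBundle (n := n) (Sphere n) => (ξ.proj : 𝔼 (n + 1))) := by
  have := Fact.mk (@finrank_euclideanSpace_fin ℝ _ (n + 1))
  have h : ContMDiff (𝓡 n) 𝓘(ℝ, 𝔼 (n + 1)) ∞ ((↑) : Sphere n → 𝔼 (n + 1)) := contMDiff_coe_sphere
  exact h.comp (fun ξ₀ => ((contMDiffAt_hom_bundle
    (fun ξ : CotangentBundle (n := n) (Sphere n) => ξ)).1 contMDiffAt_id).1)

theorem contDiff_momentumEnergy {V ι : Type*} [NormedAddCommGroup V] [NormedSpace ℝ V] [Fintype ι]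
    (σ τ : ι → ι → ℝ) (u : ι → ℝ) {Y Z : V → ι → ℝ} {k : WithTop ℕ∞}
    (hY : ∀ a, ContDiff ℝ k fun v => Y v a) (hZ : ∀ a, ContDiff ℝ k fun v => Z v a) :
    ContDiff ℝ k fun v => momentumEnergy σ τ u (Y v) (Z v) := by
  have hM : ∀ a b, ContDiff ℝ k fun v => angularMomentum (Y v) (Z v) a b :=
    fun a b => ((hY a).mul (hZ b)).sub ((hY b).mul (hZ a))
  unfold momentumEnergy
  exact ((contDiff_const.mul (ContDiff.sum fun a _ => ContDiff.sum fun b _ =>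
    contDiff_const.mul ((hM a b).pow 2))).add (contDiff_const.mul (ContDiff.sum fun a _ =>
    contDiff_const.mul ((hY a).pow 2)))).add (contDiff_const.mul (ContDiff.sum fun a _ =>
    ContDiff.sum fun b _ => contDiff_const.mul (hM a b)))

theorem contMDiff_sphereIntegral (f : OrthonormalBasis (Fin (n + 1)) ℝ (𝔼 (n + 1)))
    (K : (𝔼 (n + 1)) →L[ℝ] 𝔼 (n + 1)) (σ τ : Fin (n + 1) → Fin (n + 1) → ℝ)
    (u : Fin (n + 1) → ℝ) :
    ContMDiff ((𝓡 n).prod 𝓘(ℝ, (𝔼 n) →L[ℝ] ℝ)) 𝓘(ℝ, ℝ) ∞ (sphereIntegral f K σ τ u) := by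
  have h := contDiff_momentumEnergy σ τ u (k := ∞)
    (Y := fun z : (𝔼 (n + 1)) × 𝔼 (n + 1) => fun a => inner ℝ (f a) z.1)
    (Z := fun z => fun a => inner ℝ (f a) (z.2 + K z.1))
    (fun a => (innerSL ℝ (f a)).contDiff.comp contDiff_fst)
    (fun a => (innerSL ℝ (f a)).contDiff.comp
      (contDiff_snd.add (K.contDiff.comp contDiff_fst)))
  have h2 := h.contMDiff.comp (contMDiff_proj_coe.prodMk_space contMDiff_velocity)
  exact h2.congr fun ξ => rfl

end Smoothness

section Kinetic

variable {n : ℕ}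

local notation "𝔼" k => EuclideanSpace ℝ (Fin k)

/-- The kinetic Hamiltonian is half the squared length of the velocity. -/
theorem kineticHamiltonian_eq (ξ : CotangentBundle (n := n) (Sphere n)) :
    kineticHamiltonian (roundMetric n) ξ = 1 / 2 * inner ℝ (velocity ξ) (velocity ξ) := by
  let T : (𝔼 n) →L[ℝ] 𝔼 (n + 1) := inclusionDeriv ξ.proj
  let p : (𝔼 n) →L[ℝ] ℝ := ξ.snd
  have hT : Function.Injective T := inclusionDeriv_injective ξ.proj
  let b : Fin n → 𝔼 n := fun i => EuclideanSpace.single i (1 : ℝ)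
  let G : Matrix (Fin n) (Fin n) ℝ := Matrix.of fun i j => inner ℝ (T (b i)) (T (b j))
  have hk : kineticHamiltonian (roundMetric n) ξ
      = 1 / 2 * ∑ i, ∑ j, G⁻¹ i j * p (b i) * p (b j) := rfl
  obtain ⟨u, hu⟩ : ∃ u : 𝔼 n, T u = velocity ξ := ⟨_, rfl⟩
  have hexp : ∀ u : 𝔼 n, u = ∑ i, u i • b i := fun u => by
    ext j
    simp [b, Finset.sum_apply, Pi.single_apply]
  have hGmul : ∀ (u : 𝔼 n) j, G.mulVec u j = inner ℝ (T (b j)) (T u) := fun u j => by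
    conv_rhs => rw [hexp u, map_sum, inner_sum]
    simp only [Matrix.mulVec, dotProduct, G, Matrix.of_apply, map_smul, inner_smul_right]
    exact Finset.sum_congr rfl fun i _ => mul_comm _ _
  have hdet : IsUnit G.det := by
    rw [isUnit_iff_ne_zero]
    intro h0
    obtain ⟨c, hc0, hc⟩ := Matrix.exists_mulVec_eq_zero_iff.2 h0
    have h1 : inner ℝ (T (WithLp.toLp 2 c)) (T (WithLp.toLp 2 c)) = 0 := by
      conv_lhs => enter [2]; rw [hexp (WithLp.toLp 2 c)]
      rw [map_sum, sum_inner]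
      refine Finset.sum_eq_zero fun i _ => ?_
      rw [map_smul, inner_smul_left, ← hGmul]
      show _ * G.mulVec c i = 0
      rw [hc]
      simp
    have h2 : WithLp.toLp 2 c = 0 := hT (by rw [map_zero]; exact inner_self_eq_zero.1 h1)
    exact hc0 (by simpa using h2)
  have hp : ∀ w : 𝔼 n, p w = inner ℝ (T u) (T w) := fun w => by
    rw [hu]; exact (inner_velocity ξ w).symm
  have hpG : (fun j => p (b j)) = G.mulVec u := by
    ext j
    rw [hp, hGmul, real_inner_comm]
  have hinv : G⁻¹.mulVec (fun j => p (b j)) = u := by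
    rw [hpG, Matrix.mulVec_mulVec, Matrix.nonsing_inv_mul _ hdet, Matrix.one_mulVec]
  rw [hk, ← hu]
  congr 1
  rw [← hp]
  conv_rhs => rw [hexp u, map_sum]
  refine Finset.sum_congr rfl fun i _ => ?_
  rw [map_smul, smul_eq_mul, ← hinv]
  simp only [Matrix.mulVec, dotProduct, Finset.sum_mul]
  exact Finset.sum_congr rfl fun j _ => by ring

theorem sum_blockRotation_sq (N : ℕ) (κ : ℕ → ℝ) (hκ : ∀ l, N ≤ 2 * l + 1 → κ l = 0)
    (y : Fin N → ℝ) :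
    ∑ a : Fin N, (∑ c : Fin N, κ (a / 2) * blockRotation a c * y c) ^ 2
      = ∑ c : Fin N, κ (c / 2) ^ 2 * y c ^ 2 := by
  have hdiag : ∀ a c d : Fin N, c ≠ d → blockRotation a c * blockRotation a d = 0 := by
    intro a c d hcd
    by_contra h
    have h1 := blockRotation_ne_zero (left_ne_zero_of_mul h)
    have h2 := blockRotation_ne_zero (right_ne_zero_of_mul h)
    have h3 : ∀ k : ℕ, blockRotation k k = 0 := fun k => by simp [blockRotation]
    have h4 : (a : ℕ) ≠ c := fun h' => left_ne_zero_of_mul h (by rw [h', h3])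
    have h5 : (a : ℕ) ≠ d := fun h' => right_ne_zero_of_mul h (by rw [h', h3])
    have h6 : (c : ℕ) ≠ d := fun h' => hcd (Fin.ext h')
    omega
  have hsq : ∀ c : Fin N, ∑ a : Fin N, κ (a / 2) ^ 2 * blockRotation a c ^ 2 = κ (c / 2) ^ 2 := by
    intro c
    by_cases hl : N ≤ 2 * (c / 2 : ℕ) + 1
    · rw [hκ _ hl]
      refine (Finset.sum_eq_zero fun a _ => ?_).trans (by simp)
      by_cases h : blockRotation a c = 0
      · simp [h]
      · rw [blockRotation_ne_zero h, hκ _ hl]; simp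
    · push Not at hl
      rcases Nat.even_or_odd' (c : ℕ) with ⟨l, hc | hc⟩
      · have hlt : 2 * l + 1 < N := by omega
        rw [Finset.sum_eq_single ⟨2 * l + 1, hlt⟩]
        · have : blockRotation (2 * l + 1) c = -1 := by simp [blockRotation, hc]
          simp only [this]
          have h2 : (2 * l + 1) / 2 = (c : ℕ) / 2 := by omega
          rw [h2]; ring
        · intro a _ ha
          have hne : (a : ℕ) ≠ 2 * l + 1 := fun h => ha (Fin.ext h)
          have : blockRotation a c = 0 := by
            unfold blockRotation
            rw [if_neg, if_neg]
            · rintro ⟨h, -⟩; omega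
            · rintro ⟨h, k, hk⟩; omega
          rw [this]; ring
        · simp
      · have hlt : 2 * l < N := by omega
        rw [Finset.sum_eq_single ⟨2 * l, hlt⟩]
        · have : blockRotation (2 * l) c = 1 := by simp [blockRotation, hc]
          simp only [this]
          have h2 : (2 * l) / 2 = (c : ℕ) / 2 := by omega
          rw [h2]; ring
        · intro a _ ha
          have hne : (a : ℕ) ≠ 2 * l := fun h => ha (Fin.ext h)
          have : blockRotation a c = 0 := by
            unfold blockRotation
            rw [if_neg, if_neg]
            · rintro ⟨h, k, hk⟩; omega
            · rintro ⟨h, k, hk⟩; omega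
          rw [this]; ring
        · simp
  have h1 : ∀ a : Fin N, (∑ c : Fin N, κ (a / 2) * blockRotation a c * y c) ^ 2
      = ∑ c : Fin N, κ (a / 2) ^ 2 * blockRotation a c ^ 2 * y c ^ 2 := fun a => by
    rw [sq, Finset.sum_mul_sum]
    refine Finset.sum_congr rfl fun c _ => ?_
    rw [Finset.sum_eq_single c]
    · ring
    · intro d _ hd
      linear_combination κ (a / 2) ^ 2 * y c * y d * hdiag a c d hd.symm
    · simp
  rw [Finset.sum_congr rfl fun a _ => h1 a, Finset.sum_comm]
  exact Finset.sum_congr rfl fun c _ => by rw [← Finset.sum_mul, hsq]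

/-- The Hamiltonian of the magnetic geodesic flow in terms of the gauged momentum. -/
theorem kineticHamiltonian_eq_sphereIntegral
    {f : OrthonormalBasis (Fin (n + 1)) ℝ (𝔼 (n + 1))} {K : (𝔼 (n + 1)) →L[ℝ] 𝔼 (n + 1)}
    {κ : ℕ → ℝ} (hf : ∀ a c, inner ℝ (f a) (K (f c)) = κ (a / 2) * blockRotation a c)
    (hκ : ∀ l, n + 1 ≤ 2 * l + 1 → κ l = 0) (ξ : CotangentBundle (n := n) (Sphere n)) :
    kineticHamiltonian (roundMetric n) ξ
      = sphereIntegral f K (fun _ _ => 1) (fun a c => κ (a / 2) * blockRotation a c)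
        (fun a => κ (a / 2) ^ 2) ξ := by
  have hτ : ∀ a c : Fin (n + 1),
      κ (a / 2) * blockRotation a c = -(κ (c / 2) * blockRotation c a) := fun a c => by
    by_cases h : blockRotation a c = 0
    · rw [blockRotation_antisymm c a, h]; simp
    · rw [blockRotation_ne_zero h, blockRotation_antisymm c a]; ring
  let x : 𝔼 (n + 1) := ξ.proj
  let y : Fin (n + 1) → ℝ := fun a => inner ℝ (f a) x
  let w := gaugedMomentum K ξ
  let z : Fin (n + 1) → ℝ := fun a => inner ℝ (f a) w
  have hx1 : inner ℝ x x = (1 : ℝ) := by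
    rw [real_inner_self_eq_norm_sq, mem_sphere_zero_iff_norm.1 ξ.proj.2]; norm_num
  have hparseval : ∀ v v' : 𝔼 (n + 1), inner ℝ v v' = ∑ a, inner ℝ (f a) v * inner ℝ (f a) v' :=
    fun v v' => by
      rw [← f.sum_inner_mul_inner]
      exact Finset.sum_congr rfl fun a _ => by rw [real_inner_comm]
  have hKx : ∀ a, inner ℝ (f a) (K x) = ∑ c : Fin (n + 1), κ (a / 2) * blockRotation a c * y c :=
    fun a => by
      conv_lhs => rw [← f.sum_repr' x, map_sum, inner_sum]
      exact Finset.sum_congr rfl fun c _ => by rw [map_smul, inner_smul_right, hf, mul_comm]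
  have hxK : inner ℝ x (K x) = 0 := by
    rw [hparseval]
    simp only [hKx, Finset.mul_sum]
    refine sum_eq_zero_of_antisymm _ fun a c => ?_
    rw [hτ a c]
    ring
  have hxw : inner ℝ x w = 0 := by
    rw [show w = velocity ξ + K x from rfl, inner_add_right, hxK, inner_velocity_self ξ, add_zero]
  have hww : ∑ a, ∑ b, angularMomentum y z a b ^ 2 = 2 * inner ℝ w w := by
    have h1 : ∑ a, ∑ b, angularMomentum y z a b ^ 2
        = 2 * ((∑ a, y a * y a) * ∑ b, z b * z b) - 2 * ((∑ a, y a * z a) * ∑ b, y b * z b) := by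
      have h2 : (∑ a, y a * y a) * ∑ b, z b * z b = (∑ b, z b * z b) * ∑ a, y a * y a := mul_comm _ _
      rw [two_mul]
      nth_rewrite 2 [h2]
      simp only [Finset.sum_mul_sum]
      simp only [Finset.mul_sum, ← Finset.sum_add_distrib,
        ← Finset.sum_sub_distrib]
      exact Finset.sum_congr rfl fun a _ => Finset.sum_congr rfl fun b _ => by
        simp only [angularMomentum]; ring
    rw [h1, ← hparseval x x, ← hparseval w w, ← hparseval x w, hx1, hxw]
    ring
  have hwK : inner ℝ w (K x) = - (1 / 2 * ∑ a : Fin (n + 1), ∑ b : Fin (n + 1),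
      κ (a / 2) * blockRotation a b * angularMomentum y z a b) := by
    rw [hparseval, ← sub_eq_zero]
    simp only [hKx, Finset.mul_sum, ← Finset.sum_neg_distrib, ← Finset.sum_sub_distrib]
    refine sum_eq_zero_of_antisymm _ fun a c => ?_
    simp only [angularMomentum]
    rw [hτ a c]
    ring
  have hKK : inner ℝ (K x) (K x) = ∑ c : Fin (n + 1), κ (c / 2) ^ 2 * y c ^ 2 := by
    rw [← sum_blockRotation_sq (n + 1) κ hκ y, hparseval]
    exact Finset.sum_congr rfl fun a _ => by rw [hKx, sq]
  have hv : velocity ξ = w - K x := (add_sub_cancel_right _ _).symm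
  rw [kineticHamiltonian_eq, hv, inner_sub_left, inner_sub_right, inner_sub_right,
    real_inner_comm w (K x), hKK, hwK]
  show _ = momentumEnergy _ _ _ y z
  simp only [momentumEnergy, one_mul, hww]
  ring

end Kinetic

section MomentumDegree

variable {n : ℕ}

local notation "𝔼" k => EuclideanSpace ℝ (Fin k)

/-- Every tangent vector represents a covector. -/
theorem exists_velocity_eq (x : Sphere n) {v : 𝔼 (n + 1)}
    (hv : inner ℝ (x : 𝔼 (n + 1)) v = 0) :
    ∃ p : CotangentSpace (n := n) x, velocity (⟨x, p⟩ : CotangentBundle (n := n) (Sphere n)) = v := by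
  let p : (𝔼 n) →L[ℝ] ℝ := (innerSL ℝ v).comp (inclusionDeriv x : (𝔼 n) →L[ℝ] 𝔼 (n + 1))
  refine ⟨p, eq_of_inner_inclusionDeriv (x := x) (inner_velocity_self _) hv fun u => ?_⟩
  exact inner_velocity (⟨x, p⟩ : CotangentBundle (n := n) (Sphere n)) u

theorem velocity_add (x : Sphere n) (p q : CotangentSpace (n := n) x) :
    velocity (⟨x, p + q⟩ : CotangentBundle (n := n) (Sphere n))
      = velocity (⟨x, p⟩ : CotangentBundle (n := n) (Sphere n)) + velocity ⟨x, q⟩ :=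
  dualLift_add (E := 𝔼 n) (inclusionDeriv x) p q

theorem velocity_smul (x : Sphere n) (c : ℝ) (p : CotangentSpace (n := n) x) :
    velocity (⟨x, c • p⟩ : CotangentBundle (n := n) (Sphere n))
      = c • velocity (⟨x, p⟩ : CotangentBundle (n := n) (Sphere n)) :=
  dualLift_smul (E := 𝔼 n) (inclusionDeriv x) c p

/-- The angular momentum of the velocity as a linear function of the covector. -/
noncomputable def velocityMomentum (f : OrthonormalBasis (Fin (n + 1)) ℝ (𝔼 (n + 1))) (x : Sphere n)
    (a b : Fin (n + 1)) : CotangentSpace (n := n) x →ₗ[ℝ] ℝ where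
  toFun p := angularMomentum (fun a => inner ℝ (f a) (x : 𝔼 (n + 1)))
    (fun a => inner ℝ (f a) (velocity (⟨x, p⟩ : CotangentBundle (n := n) (Sphere n)))) a b
  map_add' p q := by
    simp only [angularMomentum, velocity_add, inner_add_right]; ring
  map_smul' c p := by
    simp only [angularMomentum, velocity_smul, inner_smul_right, RingHom.id_apply, smul_eq_mul]
    ring

theorem velocityMomentum_apply (f : OrthonormalBasis (Fin (n + 1)) ℝ (𝔼 (n + 1))) (x : Sphere n)
    (a b : Fin (n + 1)) (p : CotangentSpace (n := n) x) :
    velocityMomentum f x a b p = angularMomentum (fun a => inner ℝ (f a) (x : 𝔼 (n + 1)))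
      (fun a => inner ℝ (f a) (velocity (⟨x, p⟩ : CotangentBundle (n := n) (Sphere n)))) a b :=
  rfl

variable {f : OrthonormalBasis (Fin (n + 1)) ℝ (𝔼 (n + 1))} {K : (𝔼 (n + 1)) →L[ℝ] 𝔼 (n + 1)}
  {σ τ : Fin (n + 1) → Fin (n + 1) → ℝ} {u : Fin (n + 1) → ℝ}

theorem exists_linear_part (f : OrthonormalBasis (Fin (n + 1)) ℝ (𝔼 (n + 1)))
    (hσ : ∀ a b, σ a b = σ b a) (hτ : ∀ a b, τ a b = - τ b a) (x : Sphere n)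
    (z : Fin (n + 1) → ℝ) :
    ∃ V : TangentSpace (𝓡 n) x,
      inclusionDeriv x V
        = ∑ c, gradMomentum σ τ (fun a => inner ℝ (f a) (x : 𝔼 (n + 1))) z c • f c ∧
      ∀ ξ : CotangentSpace (n := n) x, ξ V
        = ∑ c, gradMomentum σ τ (fun a => inner ℝ (f a) (x : 𝔼 (n + 1))) z c
          * inner ℝ (f c) (velocity (⟨x, ξ⟩ : CotangentBundle (n := n) (Sphere n))) := by
  obtain ⟨V, hV⟩ := (range_inclusionDeriv x
    (∑ c, gradMomentum σ τ (fun a => inner ℝ (f a) (x : 𝔼 (n + 1))) z c • f c)).2 (by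
      rw [inner_sum_smul_basis]
      exact sum_mul_gradMomentum hσ hτ _ _)
  refine ⟨V, hV, fun ξ => ?_⟩
  have h := inner_velocity (⟨x, ξ⟩ : CotangentBundle (n := n) (Sphere n)) V
  refine h.symm.trans ?_
  show inner ℝ _ (inclusionDeriv x V) = _
  rw [hV, inner_sum_smul_basis]
  exact Finset.sum_congr rfl fun c _ => mul_comm _ _

theorem sphereIntegral_expansion (hσ : ∀ a b, σ a b = σ b a) (hτ : ∀ a b, τ a b = - τ b a)
    (x : Sphere n) (ξ : CotangentSpace (n := n) x) :
    sphereIntegral f K σ τ u ⟨x, ξ⟩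
      = 1 / 4 * ∑ a, ∑ b, σ a b * velocityMomentum f x a b ξ ^ 2
        + ∑ c, gradMomentum σ τ (fun a => inner ℝ (f a) (x : 𝔼 (n + 1)))
          (fun a => inner ℝ (f a) (K x)) c
          * inner ℝ (f c) (velocity (⟨x, ξ⟩ : CotangentBundle (n := n) (Sphere n)))
        + momentumEnergy σ τ u (fun a => inner ℝ (f a) (x : 𝔼 (n + 1)))
          (fun a => inner ℝ (f a) (K x)) := by
  have h := momentumEnergy_add u hσ hτ (fun a => inner ℝ (f a) (x : 𝔼 (n + 1)))
    (fun a => inner ℝ (f a) (K x))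
    (fun a => inner ℝ (f a) (velocity (⟨x, ξ⟩ : CotangentBundle (n := n) (Sphere n))))
  refine Eq.trans ?_ h
  unfold sphereIntegral
  congr 1
  ext a
  show inner ℝ (f a) (velocity _ + K x) = inner ℝ (f a) (K x) + _
  rw [inner_add_right, add_comm]

theorem isQuadraticInMomenta_sphereIntegral (hσ : ∀ a b, σ a b = σ b a)
    (hτ : ∀ a b, τ a b = - τ b a) {a₀ b₀ : Fin (n + 1)} (hab : a₀ ≠ b₀) (h : σ a₀ b₀ ≠ 0) :
    IsQuadraticInMomenta (sphereIntegral f K σ τ u) := by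
  choose V hV hV' using fun x : Sphere n => exists_linear_part f hσ hτ x
    (fun a => inner ℝ (f a) (K x))
  let Q : ∀ x : Sphere n, QuadraticForm ℝ (CotangentSpace (n := n) x) := fun x =>
    ∑ a, ∑ b, (1 / 4 * σ a b) • QuadraticMap.linMulLin (velocityMomentum f x a b)
      (velocityMomentum f x a b)
  have hQ : ∀ x ξ, Q x ξ = 1 / 4 * ∑ a, ∑ b, σ a b * velocityMomentum f x a b ξ ^ 2 := fun x ξ => by
    simp only [Q, sum_apply, smul_apply, QuadraticMap.linMulLin_apply,
      smul_eq_mul, Finset.mul_sum]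
    exact Finset.sum_congr rfl fun a _ => Finset.sum_congr rfl fun b _ => by ring
  refine ⟨Q, V, fun x => momentumEnergy σ τ u (fun a => inner ℝ (f a) (x : 𝔼 (n + 1)))
    (fun a => inner ℝ (f a) (K x)), ?_, fun x ξ => ?_⟩
  · let x : Sphere n := ⟨f a₀, by simp⟩
    obtain ⟨p, hp⟩ := exists_velocity_eq x (v := f b₀) (f.inner_eq_zero hab)
    refine ⟨x, fun h0 => ?_⟩
    have h1 := hQ x p
    have hM : ∀ a b, velocityMomentum f x a b p
        = (if a = a₀ then 1 else 0) * (if b = b₀ then 1 else 0)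
          - (if b = a₀ then 1 else 0) * (if a = b₀ then 1 else 0) := fun a b => by
      rw [velocityMomentum_apply]
      simp only [angularMomentum, hp]
      simp only [x, f.inner_eq_ite]
    have hM2 : ∀ a b, σ a b * velocityMomentum f x a b p ^ 2
        = (if a = a₀ then (if b = b₀ then σ a b else 0) else 0)
          + (if a = b₀ then (if b = a₀ then σ a b else 0) else 0) := fun a b => by
      rw [hM]
      by_cases h1 : a = a₀ <;> by_cases h2 : b = b₀ <;> by_cases h3 : a = b₀ <;>
        by_cases h4 : b = a₀ <;> simp_all
    simp only [h0, zero_apply, hM2, Finset.sum_add_distrib] at h1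
    simp [hσ b₀ a₀] at h1
    exact h (by linarith)
  · rw [sphereIntegral_expansion hσ hτ, hQ, hV']

theorem isLinearInMomenta_sphereIntegral (hτ : ∀ a b, τ a b = - τ b a)
    {a₀ b₀ : Fin (n + 1)} (h : τ a₀ b₀ ≠ 0) :
    IsLinearInMomenta (sphereIntegral f K (fun _ _ => 0) τ u) := by
  choose V hV hV' using fun x : Sphere n => exists_linear_part (σ := fun _ _ => 0) f
    (fun _ _ => rfl) hτ x (fun a => inner ℝ (f a) (K x))
  refine ⟨V, fun x => momentumEnergy (fun _ _ => 0) τ u (fun a => inner ℝ (f a) (x : 𝔼 (n + 1)))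
    (fun a => inner ℝ (f a) (K x)), ?_, fun x ξ => ?_⟩
  · let x : Sphere n := ⟨f a₀, by simp⟩
    refine ⟨x, fun h0 => ?_⟩
    have h1 := hV x
    rw [h0] at h1
    have h2 := congrArg (fun v => inner ℝ (f b₀) v) h1
    simp only [inner_sum_smul_basis, gradMomentum, x, f.inner_eq_ite] at h2
    simp at h2
    exact h h2.symm
  · rw [sphereIntegral_expansion (fun _ _ => rfl) hτ, hV']
    simp

end MomentumDegree

section FunctionalIndependence

variable {n : ℕ}

local notation "𝔼" k => EuclideanSpace ℝ (Fin k)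

variable {e : OpenPartialHomeomorph (Sphere n) (𝔼 n)} {K : (𝔼 (n + 1)) →L[ℝ] 𝔼 (n + 1)}
  {f : OrthonormalBasis (Fin (n + 1)) ℝ (𝔼 (n + 1))}

/-- In local coordinates, almost every point lies off the coordinate hyperplanes of an orthonormal
basis. -/
theorem ae_inner_position_ne_zero (he : e ∈ IsManifold.maximalAtlas (𝓡 n) ∞ (Sphere n))
    (f : OrthonormalBasis (Fin (n + 1)) ℝ (𝔼 (n + 1))) :
    ∀ᵐ x : 𝔼 n, x ∈ e.target → ∀ a, inner ℝ (f a) (position e x) ≠ 0 := by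
  have h : ∀ a, ∀ᵐ x : 𝔼 n, x ∈ e.target → inner ℝ (f a) (position e x) ≠ 0 := fun a => by
    have h0 := measure_regular_zero_set (volume : Measure (𝔼 n)) (s := e.target)
      (h := fun x => inner ℝ (f a) (position e x))
      (h' := fun x => (innerSL ℝ (f a)).comp (fderiv ℝ (position e) x))
      (fun x hx _ => ((innerSL ℝ (f a)).hasFDerivAt).comp x (hasFDerivAt_position he hx))
      (fun x hx hzero hder => by
        obtain ⟨u, hu⟩ := (range_fderiv_position he hx (f a)).2 (by rw [real_inner_comm]; exact hzero)
        have h1 : inner ℝ (f a) (fderiv ℝ (position e) x u) = 0 := DFunLike.congr_fun hder u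
        rw [hu, real_inner_self_eq_norm_sq, f.norm_eq_one] at h1
        norm_num at h1)
    exact (measure_eq_zero_iff_ae_notMem.1 h0).mono fun x hx hxt hz => hx ⟨hxt, hz⟩
  exact (ae_all_iff.2 h).mono fun x hx hxt a => hx a hxt

/-- The vertical differentials determine linear independence. -/
theorem linearIndependent_fderiv_of_vertical {ι : Type*} [Fintype ι]
    (he : e ∈ IsManifold.maximalAtlas (𝓡 n) ∞ (Sphere n)) {z : (𝔼 n) × 𝔼 n}
    (hz : z.1 ∈ e.target) {F : ι → CotangentBundle (n := n) (Sphere n) → ℝ}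
    {P Q : ι → 𝔼 (n + 1)} (hQ : ∀ i, inner ℝ (position e z.1) (Q i) = 0)
    (hF : ∀ i η, fderiv ℝ (F i ∘ canonicalCoord e) z η
      = inner ℝ (P i) (fderiv ℝ (position e) z.1 η.1)
        + inner ℝ (Q i) (fderiv ℝ (fun z => gaugedMomentum K (canonicalCoord e z)) z η))
    (hli : LinearIndependent ℝ Q) :
    LinearIndependent ℝ fun i => fderiv ℝ (F i ∘ canonicalCoord e) z := by
  rw [Fintype.linearIndependent_iff]
  intro c hc
  refine Fintype.linearIndependent_iff.1 hli c ?_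
  obtain ⟨u, hu⟩ := (range_fderiv_position he hz (∑ i, c i • Q i)).2 (by
    rw [inner_sum]
    exact Finset.sum_eq_zero fun i _ => by rw [inner_smul_right, hQ, mul_zero])
  have h1 := DFunLike.congr_fun hc (0, u)
  simp only [sum_apply, smul_apply, hF, map_zero, inner_zero_right, zero_add, zero_apply,
    smul_eq_mul] at h1
  have h2 : inner ℝ (∑ i, c i • Q i)
      (fderiv ℝ (fun z => gaugedMomentum K (canonicalCoord e z)) z (0, u)) = 0 := by
    rw [← h1, sum_inner]
    exact Finset.sum_congr rfl fun i _ => by rw [real_inner_smul_left]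
  have h3 := inner_fderiv_velocity he hz (0, u) u
  simp only [(hasFDerivAt_gaugedMomentum he hz).fderiv, add_apply,
    ContinuousLinearMap.comp_apply, ContinuousLinearMap.coe_fst', map_zero, inner_zero_right,
    add_zero, zero_apply] at h2 h3
  rw [← hu, real_inner_comm, h3] at h2
  rw [← hu, inner_self_eq_zero.1 h2, map_zero]

/-- The part of `gradMomentum` that is linear in the momentum. -/
def gradMomentumLinear {ι : Type*} [Fintype ι] (σ : ι → ι → ℝ) (y : ι → ℝ) :
    (ι → ℝ) →ₗ[ℝ] (ι → ℝ) where
  toFun z c := ∑ a, σ a c * angularMomentum y z a c * y a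
  map_add' z z' := by
    ext c
    simp only [angularMomentum, Pi.add_apply, ← Finset.sum_add_distrib]
    exact Finset.sum_congr rfl fun a _ => by ring
  map_smul' t z := by
    ext c
    simp only [angularMomentum, Pi.smul_apply, smul_eq_mul, RingHom.id_apply, Finset.mul_sum]
    exact Finset.sum_congr rfl fun a _ => by ring

theorem gradMomentum_eq {ι : Type*} [Fintype ι] (σ τ : ι → ι → ℝ) (y z : ι → ℝ) :
    gradMomentum σ τ y z = (fun c => ∑ a, τ a c * y a) + gradMomentumLinear σ y z := by
  ext c
  simp only [gradMomentum, gradMomentumLinear, Pi.add_apply, LinearMap.coe_mk, AddHom.coe_mk,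
    ← Finset.sum_add_distrib]
  exact Finset.sum_congr rfl fun a _ => by ring

theorem exists_gaugedMomentum_eq (he : e ∈ IsManifold.maximalAtlas (𝓡 n) ∞ (Sphere n))
    (hK : ∀ a b, inner ℝ (K a) b = - inner ℝ a (K b)) {x : 𝔼 n} (hx : x ∈ e.target)
    {w : 𝔼 (n + 1)} (hw : inner ℝ (position e x) w = 0) :
    ∃ p, gaugedMomentum K (canonicalCoord e (x, p)) = w := by
  have hself : inner ℝ (position e x) (K (position e x)) = 0 := by
    have := hK (position e x) (position e x)
    rw [real_inner_comm] at this
    linarith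
  obtain ⟨u, hu⟩ := (range_fderiv_position he hx (w - K (position e x))).2 (by
    rw [inner_sub_right, hw, hself, sub_zero])
  let T := fderiv ℝ (position e) x
  obtain ⟨E, hE⟩ := exists_inducedForm_equiv (fderiv_position_injective he hx)
  refine ⟨(InnerProductSpace.toDual ℝ (𝔼 n)).symm (inducedForm T u), ?_⟩
  have h1 : innerSL ℝ ((InnerProductSpace.toDual ℝ (𝔼 n)).symm (inducedForm T u))
      = inducedForm T u := (InnerProductSpace.toDual ℝ (𝔼 n)).apply_symm_apply _
  have h2 : velocity (canonicalCoord e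
      (x, (InnerProductSpace.toDual ℝ (𝔼 n)).symm (inducedForm T u))) = w - K (position e x) := by
    rw [velocity_canonicalCoord he hx, h1, dualLift, ← hE, ContinuousLinearMap.inverse_equiv, ← hu]
    exact congrArg T (E.symm_apply_apply u)
  rw [gaugedMomentum, h2]
  exact sub_add_cancel _ _

/-- Functions of the form `sphereIntegral` are functionally independent if their gradients with
respect to the momentum are independent at some momentum over every point off the coordinate
hyperplanes. -/
theorem functionallyIndependent_sphereIntegral {ι : Type*} [Fintype ι]
    (hK : ∀ a b, inner ℝ (K a) b = - inner ℝ a (K b))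
    {σ τ : ι → Fin (n + 1) → Fin (n + 1) → ℝ} {u : ι → Fin (n + 1) → ℝ}
    (hσ : ∀ i a b, σ i a b = σ i b a) (hτ : ∀ i a b, τ i a b = - τ i b a)
    (hgen : ∀ y : Fin (n + 1) → ℝ, (∀ a, y a ≠ 0) → ∃ z : Fin (n + 1) → ℝ, ∑ a, y a * z a = 0 ∧
      LinearIndependent ℝ fun i => gradMomentum (σ i) (τ i) y z) :
    FunctionallyIndependent fun i => sphereIntegral f K (σ i) (τ i) (u i) := by
  intro e he
  let y : (𝔼 n) → Fin (n + 1) → ℝ := fun x a => inner ℝ (f a) (position e x)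
  let ζ : (𝔼 n) × (𝔼 n) → Fin (n + 1) → ℝ := fun z a =>
    inner ℝ (f a) (gaugedMomentum K (canonicalCoord e z))
  let S : (Fin (n + 1) → ℝ) →ₗ[ℝ] 𝔼 (n + 1) := Fintype.linearCombination ℝ f
  have hS : ∀ g, S g = ∑ c, g c • f c := fun g => Fintype.linearCombination_apply ℝ f g
  have hSinj : LinearMap.ker S = ⊥ :=
    LinearMap.ker_eq_bot.2 (linearIndependent_iff_injective_fintypeLinearCombination.1
      f.orthonormal.linearIndependent)
  let Q : (𝔼 n) × (𝔼 n) → ι → 𝔼 (n + 1) := fun z i =>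
    S (gradMomentum (σ i) (τ i) (y z.1) (ζ z))
  suffices hmain : ∀ᵐ z : (𝔼 n) × 𝔼 n, z.1 ∈ e.target → LinearIndependent ℝ (Q z) by
    refine hmain.mono fun z hz hzt => ?_
    refine linearIndependent_fderiv_of_vertical (K := K) he hzt (fun i => ?_)
      (fun i η => ?_) (Q := Q z)
      (P := fun i => ∑ c, gradPosition (σ i) (τ i) (u i) (y z.1) (ζ z) c • f c) (hz hzt)
    · simp only [Q, hS, inner_sum_smul_basis]
      exact sum_mul_gradMomentum (hσ i) (hτ i) _ _
    · simp only [Q, hS]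
      exact fderiv_sphereIntegral he (hσ i) (hτ i) hzt η
  have hcont : ContinuousOn Q (e.target ×ˢ Set.univ) := by
    have hy : ∀ a, ContinuousOn (fun z : (𝔼 n) × 𝔼 n => y z.1 a) (e.target ×ˢ Set.univ) := fun a =>
      (innerSL ℝ (f a)).continuous.comp_continuousOn
        ((contDiffOn_position he).continuousOn.comp continuousOn_fst fun z hz => hz.1)
    have hζ : ∀ a, ContinuousOn (fun z => ζ z a) (e.target ×ˢ Set.univ) := fun a =>
      (innerSL ℝ (f a)).continuous.comp_continuousOn (contDiffOn_gaugedMomentum he).continuousOn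
    refine continuousOn_pi.2 fun i => (LinearMap.continuous_of_finiteDimensional S).comp_continuousOn
      (continuousOn_pi.2 fun c => ?_)
    unfold gradMomentum angularMomentum
    exact continuousOn_finsetSum _ fun a _ => ((continuousOn_const.mul
      (((hy a).mul (hζ c)).sub ((hy c).mul (hζ a)))).add continuousOn_const).mul (hy a)
  have hmeas : MeasurableSet {z : (𝔼 n) × 𝔼 n | z.1 ∈ e.target → LinearIndependent ℝ (Q z)} := by
    have hU : IsOpen (e.target ×ˢ (Set.univ : Set (𝔼 n))) := e.open_target.prod isOpen_univ
    have hO := hcont.isOpen_inter_preimage hU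
      (isOpen_setOfPred_linearIndependent (𝕜 := ℝ) (E := 𝔼 (n + 1)) (ι := ι))
    refine (hU.measurableSet.compl.union hO.measurableSet).congr ?_
    ext z
    by_cases hz : z.1 ∈ e.target <;> simp [hz]
  rw [Measure.volume_eq_prod, Measure.ae_prod_iff_ae_ae hmeas]
  filter_upwards [ae_inner_position_ne_zero he f] with x hx
  by_cases hxt : x ∈ e.target
  swap
  · exact Filter.Eventually.of_forall fun p h => absurd h hxt
  obtain ⟨z₀, hz₀, hli⟩ := hgen (y x) (hx hxt)
  obtain ⟨p₀, hp₀⟩ := exists_gaugedMomentum_eq he hK hxt (w := ∑ c, z₀ c • f c) (by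
    rw [inner_sum_smul_basis]; exact hz₀)
  have hζ₀ : ζ (x, p₀) = z₀ := by
    ext a
    simp only [ζ, hp₀]
    rw [f.orthonormal.inner_right_fintype]
  let T := fderiv ℝ (position e) x
  let lift : (𝔼 n) →ₗ[ℝ] 𝔼 (n + 1) :=
    (T.comp ((inducedForm T).inverse.comp
      (LinearMap.toContinuousBilinearMap (innerₗ (𝔼 n))))).toLinearMap
  let coords : (𝔼 (n + 1)) →ₗ[ℝ] (Fin (n + 1) → ℝ) :=
    LinearMap.pi fun a => (innerSL ℝ (f a)).toLinearMap
  have hζ : ∀ p, ζ (x, p) = coords (K (position e x)) + coords (lift p) := fun p => by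
    ext a
    simp only [ζ, gaugedMomentum, velocity_canonicalCoord he (z := (x, p)) hxt, inner_add_right]
    exact add_comm _ _
  let a : ι → 𝔼 (n + 1) := fun i => S ((fun c => ∑ a, τ i a c * y x a)
    + gradMomentumLinear (σ i) (y x) (coords (K (position e x))))
  let b : ι → (𝔼 n) →L[ℝ] 𝔼 (n + 1) := fun i => LinearMap.toContinuousLinearMap
    (S ∘ₗ gradMomentumLinear (σ i) (y x) ∘ₗ coords ∘ₗ lift)
  have hQ : ∀ p i, Q (x, p) i = a i + b i p := fun p i => by
    simp only [Q, gradMomentum_eq, hζ, map_add, a, b, add_assoc]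
    rfl
  have hae := ae_linearIndependent_affine volume a b p₀ (by
    have h1 : (fun i => a i + b i p₀) = S ∘ fun i => gradMomentum (σ i) (τ i) (y x) z₀ := by
      ext1 i
      rw [← hQ, ← hζ₀]
      rfl
    rw [h1]
    exact hli.map' S hSinj)
  filter_upwards [hae] with p hp _
  have h1 : Q (x, p) = fun i => a i + b i p := funext (hQ p)
  rw [h1]
  exact hp

end FunctionalIndependence

section BlockIntegrals

variable {n k m : ℕ}

/-- The block of size at most two that contains a given index. -/
def blockIndex (hk : n / 2 = k + 1) (a : Fin (n + 1)) : Fin (k + 2) := ⟨a / 2, by omega⟩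

theorem blockRotation_block_antisymm (t : ℕ → ℝ) (a c : ℕ) :
    t (a / 2) * blockRotation a c = -(t (c / 2) * blockRotation c a) := by
  by_cases h : blockRotation a c = 0
  · rw [blockRotation_antisymm c a, h]; ring
  · rw [blockRotation_ne_zero h, blockRotation_antisymm a c]; ring

theorem blockRotation_mul_eq_zero (hk : n / 2 = k + 1) {g : Fin (k + 2) → ℝ} (r : ℝ)
    (a c : Fin (n + 1)) :
    r * blockRotation a c * (g (blockIndex hk a) - g (blockIndex hk c)) = 0 := by
  by_cases h : blockRotation a c = 0
  · rw [h]; ring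
  · have : blockIndex hk a = blockIndex hk c := Fin.ext (blockRotation_ne_zero h)
    rw [this]; ring

theorem bracket_block (hk : n / 2 = k + 1) {s s' : Fin (k + 2) → Fin (k + 2) → ℝ}
    {w w' : Fin (k + 2) → ℝ} (hs : ∀ i j, s i j = s j i) (hs' : ∀ i j, s' i j = s' j i)
    (htri : ∀ i j l, s i j * s' j l - s' i j * s j l + (s j l * s' l i - s' j l * s l i)
      + (s l i * s' i j - s' l i * s i j) = 0)
    (hw : ∀ i j, s i j * (w' i - w' j) = s' i j * (w i - w j)) (t t' : ℕ → ℝ)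
    (y z : Fin (n + 1) → ℝ) :
    ∑ c, (gradPosition (fun a c => s' (blockIndex hk a) (blockIndex hk c))
          (fun a c => t' (a / 2) * blockRotation a c) (fun a => w' (blockIndex hk a)) y z c
        * gradMomentum (fun a c => s (blockIndex hk a) (blockIndex hk c))
          (fun a c => t (a / 2) * blockRotation a c) y z c
      - gradPosition (fun a c => s (blockIndex hk a) (blockIndex hk c))
          (fun a c => t (a / 2) * blockRotation a c) (fun a => w (blockIndex hk a)) y z c
        * gradMomentum (fun a c => s' (blockIndex hk a) (blockIndex hk c))
          (fun a c => t' (a / 2) * blockRotation a c) y z c) = 0 := by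
  apply bracket_momentumEnergy
  · exact fun _ _ => hs _ _
  · exact fun _ _ => hs' _ _
  · exact fun a b => blockRotation_block_antisymm t a b
  · exact fun a b => blockRotation_block_antisymm t' a b
  · exact fun _ _ => hw _ _
  · exact fun _ _ _ => htri _ _ _
  · exact fun a b c => blockRotation_mul_eq_zero hk (g := s' (blockIndex hk b)) _ a c
  · exact fun a c => blockRotation_mul_eq_zero hk _ a c
  · exact fun a b c => blockRotation_mul_eq_zero hk (g := s (blockIndex hk b)) _ a c
  · exact fun a c => blockRotation_mul_eq_zero hk _ a c
  intro a b c
  by_cases ha : blockRotation a c = 0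
  · rw [ha]; ring
  by_cases hb : blockRotation b c = 0
  · rw [hb]; ring
  rw [blockRotation_ne_zero ha, blockRotation_ne_zero hb]; ring

/-- Summing the pairing of the momentum gradient with the position over one block. -/
theorem sum_block_gradMomentum (hk : n / 2 = k + 1) (s : Fin (k + 2) → Fin (k + 2) → ℝ)
    (hs : ∀ i j, s i j = s j i) (t : ℕ → ℝ) (y : Fin (n + 1) → ℝ) (ρ : Fin (k + 2) → ℝ)
    (j : Fin (k + 2)) :
    ∑ c, (if blockIndex hk c = j then 1 else 0) * (y c * gradMomentum
        (fun a c => s (blockIndex hk a) (blockIndex hk c))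
        (fun a c => t (a / 2) * blockRotation a c) y (fun a => ρ (blockIndex hk a) * y a) c)
      = (∑ c, if blockIndex hk c = j then y c ^ 2 else 0) * ∑ i, s j i
        * (∑ a, if blockIndex hk a = i then y a ^ 2 else 0) * (ρ j - ρ i) := by
  have h1 : ∑ i, s j i * (∑ a, if blockIndex hk a = i then y a ^ 2 else 0) * (ρ j - ρ i)
      = ∑ a, s j (blockIndex hk a) * y a ^ 2 * (ρ j - ρ (blockIndex hk a)) := by
    simp only [Finset.mul_sum, Finset.sum_mul]
    rw [Finset.sum_comm]
    refine Finset.sum_congr rfl fun a _ => ?_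
    rw [Finset.sum_eq_single (blockIndex hk a)]
    · simp
    · intro i _ hi
      simp [hi.symm]
    · simp
  have h2 : ∑ c : Fin (n + 1), ∑ a : Fin (n + 1), (if blockIndex hk c = j then (1 : ℝ) else 0)
      * (t (a / 2) * blockRotation a c * y a * y c) = 0 := by
    refine sum_eq_zero_of_antisymm _ fun a c => ?_
    have h3 := blockRotation_mul_eq_zero hk (g := fun i => if i = j then (1 : ℝ) else 0)
      (t (c / 2)) c a
    have h4 := blockRotation_block_antisymm t a c
    rw [h4]
    linear_combination -(y a * y c) * h3
  rw [h1, Finset.sum_mul_sum]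
  refine Eq.trans ?_ ((congrArg (_ + ·) h2).trans (add_zero _))
  rw [← Finset.sum_add_distrib]
  refine Finset.sum_congr rfl fun c _ => ?_
  rw [gradMomentum, Finset.mul_sum, Finset.mul_sum, ← Finset.sum_add_distrib]
  refine Finset.sum_congr rfl fun a _ => ?_
  by_cases h : blockIndex hk c = j
  · subst h
    simp only [if_true, angularMomentum]
    rw [hs (blockIndex hk a)]
    ring
  · simp [h]

/-- The coefficients of the quadratic parts of the integrals. -/
def blockCoefficient (s : Fin (k + 1) → Fin (k + 2) → Fin (k + 2) → ℝ) :
    Fin (k + 1) ⊕ Fin m → Fin (k + 2) → Fin (k + 2) → ℝ :=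
  Sum.elim s fun _ _ _ => 0

/-- The coefficients of the potentials of the integrals. -/
def blockPotential (u : Fin (k + 1) → Fin (k + 2) → ℝ) :
    Fin (k + 1) ⊕ Fin m → Fin (k + 2) → ℝ :=
  Sum.elim u fun _ _ => 0

/-- The coefficients of the linear parts of the integrals. -/
def blockTwist (κ : ℕ → ℝ) : Fin (k + 1) ⊕ Fin m → ℕ → ℝ :=
  Sum.elim (fun r => if r = 0 then κ else 0) fun l => Pi.single (l : ℕ) 1

theorem exists_linearIndependent_gradMomentum_block (hk : n / 2 = k + 1) (hm : 2 * m ≤ n + 1)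
    {s : Fin (k + 1) → Fin (k + 2) → Fin (k + 2) → ℝ} (hs : ∀ r i j, s r i j = s r j i)
    (htri : ∀ r r' i j l, s r i j * s r' j l - s r' i j * s r j l
      + (s r j l * s r' l i - s r' j l * s r l i)
      + (s r l i * s r' i j - s r' l i * s r i j) = 0)
    (hind : ∀ c : Fin (k + 1) → ℝ, (∀ i j, i ≠ j → ∑ r, c r * s r i j = 0) → c = 0)
    (κ : ℕ → ℝ) (y : Fin (n + 1) → ℝ) (hy : ∀ a, y a ≠ 0) :
    ∃ z : Fin (n + 1) → ℝ, ∑ a, y a * z a = 0 ∧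
      LinearIndependent ℝ fun i : Fin (k + 1) ⊕ Fin m => gradMomentum
        (fun a c => blockCoefficient s i (blockIndex hk a) (blockIndex hk c))
        (fun a c => blockTwist κ i (a / 2) * blockRotation a c) y z := by
  let q : Fin (k + 2) → ℝ := fun j => ∑ a, if blockIndex hk a = j then y a ^ 2 else 0
  have hq : ∀ j, 0 < q j := fun j => by
    refine Finset.sum_pos' (fun a _ => by split_ifs <;> positivity)
      ⟨⟨2 * j, by omega⟩, Finset.mem_univ _, ?_⟩
    rw [if_pos (Fin.ext (by simp [blockIndex]))]
    have := hy ⟨2 * j, by omega⟩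
    positivity
  obtain ⟨ρ, hρ, hli⟩ := exists_laplacian_independent s q hq hs htri hind
  refine ⟨fun a => ρ (blockIndex hk a) * y a, ?_, ?_⟩
  · rw [← hρ]
    simp only [q, Finset.sum_mul]
    rw [Finset.sum_comm]
    refine Finset.sum_congr rfl fun a _ => ?_
    rw [Finset.sum_eq_single (blockIndex hk a)]
    · simp; ring
    · intro i _ hi
      simp [hi.symm]
    · simp
  rw [Fintype.linearIndependent_iff]
  intro c hc
  have hquad : (fun r => c (Sum.inl r)) = 0 := by
    refine hli _ fun j => ?_
    have h1 : ∑ a, (if blockIndex hk a = j then 1 else 0) * (y a * ∑ i, c i * gradMomentum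
        (fun a c => blockCoefficient s i (blockIndex hk a) (blockIndex hk c))
        (fun a c => blockTwist κ i (a / 2) * blockRotation a c) y
        (fun a => ρ (blockIndex hk a) * y a) a) = 0 := by
      refine Finset.sum_eq_zero fun a _ => ?_
      have h2 := congrFun hc a
      simp only [Finset.sum_apply, Pi.smul_apply, smul_eq_mul, Pi.zero_apply] at h2
      rw [h2]; ring
    have h3 : ∑ i, c i * (q j * ∑ l, blockCoefficient s i j l * q l * (ρ j - ρ l)) = 0 := by
      rw [← h1]
      simp only [Finset.mul_sum]
      rw [Finset.sum_comm (s := Finset.univ (α := Fin (n + 1)))]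
      refine Finset.sum_congr rfl fun i _ => ?_
      have h4 := sum_block_gradMomentum hk (blockCoefficient s i)
        (by rcases i with r | l; exacts [hs r, fun _ _ => rfl]) (blockTwist κ i) y ρ j
      simp only [← Finset.mul_sum]
      refine (congrArg (c i * ·) h4.symm).trans ?_
      simp only [Finset.mul_sum]
      exact Finset.sum_congr rfl fun a _ => by ring
    rw [Fintype.sum_sum_type] at h3
    simp only [blockCoefficient, Sum.elim_inl, Sum.elim_inr, zero_mul, Finset.sum_const_zero,
      mul_zero, add_zero] at h3
    have h5 : q j * ∑ r, c (Sum.inl r) * ∑ l, s r j l * q l * (ρ j - ρ l) = 0 := by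
      rw [← h3, Finset.mul_sum]
      exact Finset.sum_congr rfl fun r _ => by ring
    exact (mul_eq_zero.1 h5).resolve_left (hq j).ne'
  have hlin : ∀ l : Fin m, c (Sum.inr l) = 0 := fun l => by
    have h1 := congrFun hc ⟨2 * l + 1, by omega⟩
    simp only [Finset.sum_apply, Pi.smul_apply, smul_eq_mul, Pi.zero_apply,
      Fintype.sum_sum_type, gradMomentum, blockCoefficient, blockTwist, Sum.elim_inr,
      zero_mul, zero_add] at h1
    rw [Finset.sum_eq_zero (fun r _ => by rw [show c (Sum.inl r) = 0 from congrFun hquad r,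
      zero_mul]), zero_add, Finset.sum_eq_single l, Finset.sum_eq_single ⟨2 * l, by omega⟩] at h1
    · simpa [blockRotation, hy] using h1
    · intro a _ ha
      by_cases h : blockRotation a (2 * l + 1) = 0
      · simp only [h]; ring
      · exfalso
        unfold blockRotation at h
        simp only [ne_eq, Fin.ext_iff] at h ha
        split_ifs at h with h2 h3
        · omega
        · obtain ⟨h3, r, hr⟩ := h3; omega
        · exact h rfl
    · simp
    · intro l' _ hl'
      rw [Finset.sum_eq_zero, mul_zero]
      intro a _
      by_cases h : blockRotation a (2 * l + 1) = 0
      · simp only [h]; ring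
      · have h2 := blockRotation_ne_zero h
        have h3 : (a : ℕ) / 2 ≠ l' := fun h3 => hl' (Fin.ext (by omega))
        rw [Pi.single_eq_of_ne h3]; ring
    · simp
  rintro (r | l)
  · exact congrFun hquad r
  · exact hlin l

end BlockIntegrals

section ConstantForm

variable {E : Type*} [NormedAddCommGroup E] [InnerProductSpace ℝ E] [FiniteDimensional ℝ E]

theorem exists_skew_operator (α : E [⋀^Fin 2]→L[ℝ] ℝ) :
    ∃ K : E →L[ℝ] E, (∀ a b, α ![a, b] = 2 * inner ℝ (K a) b) ∧
      ∀ a b, inner ℝ (K a) b = - inner ℝ a (K b) := by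
  have : CompleteSpace E := FiniteDimensional.complete ℝ E
  let β : E →L[ℝ] E →L[ℝ] ℝ :=
    (continuousMultilinearCurryFin1 ℝ E ℝ).toContinuousLinearEquiv.toContinuousLinearMap.comp
      α.toContinuousMultilinearMap.curryLeft
  have hβ : ∀ a b, β a b = α ![a, b] := fun a b => by
    refine congrArg α (funext fun i => ?_)
    fin_cases i <;> rfl
  let K : E →ₗ[ℝ] E :=
    { toFun := fun a => (1 / 2 : ℝ) • (InnerProductSpace.toDual ℝ E).symm (β a)
      map_add' := fun a b => by simp
      map_smul' := fun t a => by
        rw [map_smul, map_smulₛₗ, smul_comm]; rfl }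
  have hK : ∀ a b, α ![a, b] = 2 * inner ℝ (K a) b := fun a b => by
    rw [← hβ]
    simp only [K, LinearMap.coe_mk, AddHom.coe_mk, real_inner_smul_left,
      InnerProductSpace.toDual_symm_apply]
    ring
  refine ⟨LinearMap.toContinuousLinearMap K, hK, fun a b => ?_⟩
  have h1 : α ![b, a] = - α ![a, b] := by
    refine Eq.trans ?_ (α.map_swap ![a, b] (i := 0) (j := 1) (by simp))
    refine congrArg α (funext fun i => ?_)
    fin_cases i <;> rfl
  rw [hK, hK] at h1
  rw [real_inner_comm _ a]
  simp only [LinearMap.coe_toContinuousLinearMap']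
  linarith

end ConstantForm

end MagneticSphere

open MagneticSphere in
/-- Liouville integrability of the magnetic geodesic flow on the round sphere with a constant
magnetic form, by integrals quadratic and linear in momenta. -/
theorem theorem1 (n : ℕ) (hn : 2 ≤ n)
    (α : EuclideanSpace ℝ (Fin (n + 1)) [⋀^Fin 2]→L[ℝ] ℝ) :
    ∃ F : Fin n → MagneticSphere.CotangentBundle (n := n) (MagneticSphere.Sphere n) → ℝ,
      (∀ i, ContMDiff ((𝓡 n).prod 𝓘(ℝ, EuclideanSpace ℝ (Fin n) →L[ℝ] ℝ)) 𝓘(ℝ, ℝ) ∞ (F i)) ∧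
      (∃ c : Fin n → ℝ, ∀ ξ,
        MagneticSphere.kineticHamiltonian (MagneticSphere.roundMetric n) ξ
          = ∑ i, c i * F i ξ) ∧
      (∀ i, MagneticSphere.PoissonCommute (MagneticSphere.constantMagneticForm α)
        (MagneticSphere.kineticHamiltonian (MagneticSphere.roundMetric n)) (F i)) ∧
      (∀ i j, MagneticSphere.PoissonCommute (MagneticSphere.constantMagneticForm α)
        (F i) (F j)) ∧
      MagneticSphere.FunctionallyIndependent F ∧
      (∀ i : Fin n, (i : ℕ) < n / 2 → MagneticSphere.IsQuadraticInMomenta (F i)) ∧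
      (∀ i : Fin n, n / 2 ≤ (i : ℕ) → MagneticSphere.IsLinearInMomenta (F i)) := by
  obtain ⟨k, hk⟩ : ∃ k, n / 2 = k + 1 := ⟨n / 2 - 1, by omega⟩
  obtain ⟨m, hm⟩ : ∃ m, n = k + 1 + m := ⟨n - (k + 1), by omega⟩
  obtain ⟨K, hα, hK⟩ := exists_skew_operator α
  obtain ⟨f', κ, hf', hKf, hκ⟩ := exists_skew_normal_form (n + 1) K.toLinearMap hK (by simp)
  let f : OrthonormalBasis (Fin (n + 1)) ℝ (EuclideanSpace ℝ (Fin (n + 1))) :=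
    OrthonormalBasis.mk hf' (hf'.linearIndependent.span_eq_top_of_card_eq_finrank' (by simp)).ge
  have hf : ∀ a c, inner ℝ (f a) (K (f c)) = κ (a / 2) * blockRotation a c := fun a c => by
    simp only [f, OrthonormalBasis.coe_mk]
    exact hKf a c
  obtain ⟨s, u, hs0, hu0, hs, htri, hsu, hind⟩ := exists_commuting_weights k fun i => κ i ^ 2
  let G : Fin (k + 1) ⊕ Fin m → CotangentBundle (n := n) (Sphere n) → ℝ := fun i =>
    sphereIntegral f K (fun a c => blockCoefficient s i (blockIndex hk a) (blockIndex hk c))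
      (fun a c => blockTwist κ i (a / 2) * blockRotation a c)
      (fun a => blockPotential u i (blockIndex hk a))
  let ε : Fin n ≃ Fin (k + 1) ⊕ Fin m := (finCongr hm).trans finSumFinEquiv.symm
  have hsymm : ∀ (i : Fin (k + 1) ⊕ Fin m) (j l : Fin (k + 2)),
      blockCoefficient s i j l = blockCoefficient s i l j := by
    rintro (r | l)
    exacts [hs r, fun _ _ => rfl]
  have hH : kineticHamiltonian (roundMetric n) = G (Sum.inl 0) := by
    funext ξ
    rw [kineticHamiltonian_eq_sphereIntegral hf hκ]
    simp only [G, blockCoefficient, blockTwist, blockPotential, Sum.elim_inl, hs0, hu0, if_true]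
    rfl
  have hcomm : ∀ i j, PoissonCommute (constantMagneticForm α) (G i) (G j) := fun i j =>
    poissonCommute_sphereIntegral hα hK (fun _ _ => hsymm _ _ _) (fun _ _ => hsymm _ _ _)
      (fun _ _ => blockRotation_block_antisymm _ _ _)
      (fun _ _ => blockRotation_block_antisymm _ _ _)
      (bracket_block hk (hsymm i) (hsymm j)
        (by
          rcases i with r | l <;> rcases j with r' | l' <;>
            simp [blockCoefficient, htri])
        (by
          rcases i with r | l <;> rcases j with r' | l' <;>
            simp [blockCoefficient, blockPotential]
          exact hsu r r') _ _)
  refine ⟨G ∘ ε, fun i => contMDiff_sphereIntegral _ _ _ _ _,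
    ⟨Pi.single (ε.symm (Sum.inl 0)) 1, fun ξ => ?_⟩, fun i => hH ▸ hcomm _ _,
    fun i j => hcomm _ _, ?_, fun i hi => ?_, fun i hi => ?_⟩
  · rw [hH, Finset.sum_eq_single (ε.symm (Sum.inl 0))]
    · simp
    · intro i _ hi
      simp [hi]
    · simp
  · refine functionallyIndependent_sphereIntegral (ι := Fin n) hK (fun _ _ _ => hsymm _ _ _)
      (fun _ _ _ => blockRotation_block_antisymm _ _ _) fun y hy => ?_
    obtain ⟨z, hz, hli⟩ := exists_linearIndependent_gradMomentum_block (m := m) hk (by omega)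
      hs htri hind κ y hy
    exact ⟨z, hz, hli.comp ε ε.injective⟩
  · obtain ⟨j, rfl⟩ := ε.symm.surjective i
    rcases j with r | l
    swap
    · simp [ε] at hi
      omega
    simp only [Function.comp_apply, Equiv.apply_symm_apply]
    obtain ⟨j, l, hjl, hne⟩ : ∃ j l, j ≠ l ∧ s r j l ≠ 0 := by
      by_contra! h
      have h1 := hind (Pi.single r 1) fun j l hjl => Finset.sum_eq_zero fun r' _ => by
        by_cases hr : r' = r
        · rw [hr, h j l hjl, mul_zero]
        · rw [Pi.single_eq_of_ne hr, zero_mul]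
      simpa using congrFun h1 r
    have hb : ∀ j : Fin (k + 2), blockIndex hk ⟨2 * j, by omega⟩ = j := fun j =>
      Fin.ext (by simp [blockIndex])
    refine isQuadraticInMomenta_sphereIntegral (fun _ _ => hsymm _ _ _)
      (fun _ _ => blockRotation_block_antisymm _ _ _)
      (a₀ := ⟨2 * j, by omega⟩) (b₀ := ⟨2 * l, by omega⟩) (fun h => hjl ?_) ?_
    · rw [← hb j, h, hb]
    · rw [hb, hb]
      exact hne
  · obtain ⟨j, rfl⟩ := ε.symm.surjective i
    rcases j with r | l
    · simp [ε] at hi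
      omega
    simp only [Function.comp_apply, Equiv.apply_symm_apply]
    refine isLinearInMomenta_sphereIntegral (fun _ _ => blockRotation_block_antisymm _ _ _)
      (a₀ := ⟨2 * l, by omega⟩) (b₀ := ⟨2 * l + 1, by omega⟩) ?_
    simp [blockTwist, blockRotation]
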